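/- Consider $n$ agents with nonnegative valuations $\mathbf v=(v_1,\dots,v_n)$ and a supply of $k\ge 1$ identical units; each agent wants one unit, payments are burnt, and the residual surplus of an outcome with winners $A$ and prices $(\pi_i)$ is $\sum_{i\in A}(v_i-\pi_i)$. *Benchmark.* Let $F$ be a probability distribution on $[0,\infty)$ with a density $f$ that is positive exactly on an interval (bounded or unbounded). Put $\vartheta(z)=\frac{1-F(z)}{f(z)}$, $h(q)=\vartheta(F^{-1}(q))$, $H(q)=\int_0^q h(r)\,dr$; let $G$ be the largest convex function on $[0,1)$ bounded above by $H$, let $g$ be the right derivative of $G$ on $[0,1)$, with $g(1)=\lim_{q\uparrow 1}g(q)$, and let $\bar\vartheta(z)=g(F(z))$. The mechanism $\mathrm{Mye}_F$ chooses, uniformly at random, one of the sets $A$ of at most $k$ agents that maximize $\sum_{i\in A}\bar\vartheta(v_i)$; with $x_i(\mathbf v)$ the resulting probability that $i\in A$ and $p_i(\mathbf v)=v_i x_i(\mathbf v)-\int_0^{v_i}x_i(t,\mathbf v_{-i})\,dt$, each winner $i$ pays $p_i(\mathbf v)/x_i(\mathbf v)$ and losers pay nothing. Let $\mathrm{Mye}_F(\mathbf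 v)$ denote its expected residual surplus on $\mathbf v$, and let $\mathcal G(\mathbf v)=\sup_F \mathrm{Mye}_F(\mathbf v)$, the supremum being over all such $F$. *Mechanism.* The $k$-unit $p$-lottery on a set $T$ of agents ($p\ge 0$) sells at price $p$ to the agents of $T$ with valuation greater than $p$; if there are more than $k$ of them, $k$ winners are selected uniformly at random. The $k$-unit Vickrey auction on $T$ serves the $k$ agents of $T$ with the highest valuations, each at a price equal to the $(k+1)$st highest valuation in $T$ ($0$ if there is none). The Random Sampling Optimal Lottery (RSOL) chooses a subset $S_1$ of the $n$ agents uniformly at random and lets $S_2$ be its complement; it lets $p_2\ge 0$ be a price for which the $k$-unit $p_2$-lottery on $S_2$ has maximum expected residual surplus among all prices $p\ge 0$ (such a price exists); and then, with probability $1/2$ each, it runs either the $k$-unit $p_2$-lottery or the $k$-unit Vickrey auction on $S_1$. **Theorem.** There is an absolute constant $\beta>0$ such that for all $n$, all $k\ge 1$, every valuation profile $\mathbf v\in[0,\infty)^n$, and every choice of the optimal prices $p_2$ (as a function of $S_2$), the expected residual surplus of RSOL on $\mathbf v$ is at least $\mathcal G(\mathbf v)/\beta$. -/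

import Mathlib

open scoped BigOperators

noncomputable section

namespace MoneyBurning

/-- A prior on a single valuation: an absolutely continuous probability distribution on `[0, ∞)`
whose density `f` is positive exactly on an interval (bounded or unbounded, open or closed). -/
structure Prior where
  /-- the probability density function -/
  f : ℝ → ℝ
  measurable_f : Measurable f
  f_nonneg : ∀ z, 0 ≤ f z
  interval_support : Set.OrdConnected {z | 0 < f z}
  support_nonneg : ∀ z, 0 < f z → 0 ≤ z
  integrable_f : MeasureTheory.Integrable f
  integral_f : ∫ z, f z = 1

namespace Prior

variable (P : Prior)

/-- The cumulative distribution function `F`. -/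
def F (z : ℝ) : ℝ := ∫ x in Set.Iic z, P.f x

/-- The virtual valuation for utility `ϑ(z) = (1 - F(z)) / f(z)`. -/
def virtualValue (z : ℝ) : ℝ := (1 - P.F z) / P.f z

/-- `F⁻¹`; for `0 < q < 1` this is the unique `z` with `F z = q`. -/
def quantile (q : ℝ) : ℝ := sInf {z : ℝ | 0 ≤ z ∧ q ≤ P.F z}

/-- `h(q) = ϑ(F⁻¹(q))`. -/
def h (q : ℝ) : ℝ := P.virtualValue (P.quantile q)

/-- `H(q) = ∫₀^q h(r) dr`, finite for every `q ∈ [0, 1)`. -/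
def H (q : ℝ) : ℝ := ∫ r in (0 : ℝ)..q, P.h r

/-- The convex hull of `H`: the largest convex function lying below `H`. It is taken on `[0, 1)`,
so that it also makes sense when `H(1) = ∞` (infinite mean); when `H(1)` is finite, this is the
restriction to `[0, 1)` of the convex hull on `[0, 1]`, because `H` is then continuous at `1`. -/
def G (q : ℝ) : ℝ :=
  sSup {y : ℝ | ∃ φ : ℝ → ℝ, ConvexOn ℝ (Set.Ico 0 1) φ ∧
    (∀ r ∈ Set.Ico (0 : ℝ) 1, φ r ≤ P.H r) ∧ y = φ q}

/-- The derivative `g` of `G`, extended by right-continuity on `[0, 1)`, i.e. the right derivative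
of the convex function `G`; at `1` it is the limit from the left of the nondecreasing function `g`.
(The value at `1` is only used when the support is bounded, and then `g` is bounded.) -/
def g (q : ℝ) : ℝ :=
  if q < 1 then derivWithin P.G (Set.Ici q) q
  else sSup ((fun r => derivWithin P.G (Set.Ici r) r) '' Set.Ico (0 : ℝ) 1)

/-- The ironed virtual valuation for utility `g(F(z))`. -/
def ironed (z : ℝ) : ℝ := P.g (P.F z)

end Prior

variable {n : ℕ}

/-- The feasible allocations (sets of at most `k` served agents) which maximize `∑ θ(vᵢ) xᵢ`. -/
def optAllocations (k : ℕ) (θ : ℝ → ℝ) (v : Fin n → ℝ) : Finset (Finset (Fin n)) :=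
  {A : Finset (Fin n) | A.card ≤ k ∧
    ∀ B : Finset (Fin n), B.card ≤ k → ∑ i ∈ B, θ (v i) ≤ ∑ i ∈ A, θ (v i)}

/-- `xᵢ(v)`: the probability that `i` is served when the allocation is drawn uniformly at random
from the maximizing ones. -/
def allocProb (k : ℕ) (θ : ℝ → ℝ) (v : Fin n → ℝ) (i : Fin n) : ℝ :=
  𝔼 A ∈ optAllocations k θ v, if i ∈ A then (1 : ℝ) else 0

/-- The payment rule given by the payment identity
`pᵢ(v) = vᵢ xᵢ(v) - ∫₀^{vᵢ} xᵢ(t, v₋ᵢ) dt`. -/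
def payment (k : ℕ) (θ : ℝ → ℝ) (v : Fin n → ℝ) (i : Fin n) : ℝ :=
  v i * allocProb k θ v i - ∫ t in (0 : ℝ)..v i, allocProb k θ (Function.update v i t) i

/-- `Mye_F(v)`: the expected residual surplus, on the profile `v`, of the mechanism that draws an
allocation uniformly at random from those maximizing the ironed virtual surplus and charges each
winner `i` the price `pᵢ(v) / xᵢ(v)` and each loser `0`. -/
def mye (k : ℕ) (P : Prior) (v : Fin n → ℝ) : ℝ :=
  𝔼 A ∈ optAllocations k P.ironed v,
    ∑ i ∈ A, (v i - payment k P.ironed v i / allocProb k P.ironed v i)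

/-- The benchmark `𝒢(v) = sup_F Mye_F(v)`, as a supremum of extended reals. -/
def benchmark (k : ℕ) (v : Fin n → ℝ) : EReal :=
  ⨆ P : Prior, ((mye k P v : ℝ) : EReal)

/-- The agents of `T` who want to buy at price `p`. -/
def buyers (v : Fin n → ℝ) (T : Finset (Fin n)) (p : ℝ) : Finset (Fin n) :=
  {i ∈ T | p < v i}

/-- The expected residual surplus of the `k`-unit `p`-lottery on the set `T` of agents: the winners,
who pay `p` each, are a uniformly random set of `min k b` of the `b` buyers. -/
def lottery (k : ℕ) (v : Fin n → ℝ) (T : Finset (Fin n)) (p : ℝ) : ℝ :=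
  𝔼 W ∈ (buyers v T p).powersetCard (min k (buyers v T p).card), ∑ i ∈ W, (v i - p)

/-- `p` is the price of an optimal `k`-unit lottery for `T`. -/
def IsOptimalPrice (k : ℕ) (v : Fin n → ℝ) (T : Finset (Fin n)) (p : ℝ) : Prop :=
  0 ≤ p ∧ ∀ p' : ℝ, 0 ≤ p' → lottery k v T p' ≤ lottery k v T p

/-- The valuations of the agents of `T`, in nonincreasing order. -/
def sortedValues (v : Fin n → ℝ) (T : Finset (Fin n)) : List ℝ :=
  (T.val.map v).sort (· ≥ ·)

/-- The residual surplus of the `k`-unit Vickrey auction on `T`: the `k` highest valuations win and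
each winner pays the `(k+1)`-st highest valuation (`0` if there is none). -/
def vickrey (k : ℕ) (v : Fin n → ℝ) (T : Finset (Fin n)) : ℝ :=
  (((sortedValues v T).take k).map fun x => x - (sortedValues v T).getD k 0).sum

/-- The expected residual surplus of the Random Sampling Optimal Lottery, where `price S₂` is the
price computed from the sample `S₂`: `S₁` is a uniformly random subset of the agents and `S₂` its
complement; with probability `1/2` each, the `k`-unit `price S₂`-lottery or the `k`-unit Vickrey
auction is run on `S₁`. -/
def rsol (k : ℕ) (v : Fin n → ℝ) (price : Finset (Fin n) → ℝ) : ℝ :=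
  𝔼 S₁ : Finset (Fin n), (1 / 2 * lottery k v S₁ (price S₁ᶜ) + 1 / 2 * vickrey k v S₁)

/-- Optimal lottery prices exist. -/
theorem exists_isOptimalPrice (k : ℕ) (v : Fin n → ℝ) (T : Finset (Fin n)) :
    ∃ p, IsOptimalPrice k v T p := by
  classical
  let C : Finset ℝ := insert 0 ((T.image v).filter (0 ≤ ·))
  have hC : C.Nonempty := ⟨0, Finset.mem_insert_self _ _⟩
  have hC0 : ∀ c ∈ C, 0 ≤ c := by
    intro c hc
    rcases Finset.mem_insert.1 hc with h | h
    · exact h.ge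
    · exact (Finset.mem_filter.1 h).2
  obtain ⟨p, hpC, hp⟩ := C.exists_max_image (lottery k v T) hC
  refine ⟨p, hC0 p hpC, fun p' hp' => ?_⟩
  have hD : (C.filter (· ≤ p')).Nonempty :=
    ⟨0, Finset.mem_filter.2 ⟨Finset.mem_insert_self _ _, hp'⟩⟩
  obtain ⟨c, hc, hmax⟩ := (C.filter (· ≤ p')).exists_max_image id hD
  obtain ⟨hcC, hcp⟩ := Finset.mem_filter.1 hc
  refine le_trans ?_ (hp c hcC)
  have hb : buyers v T p' = buyers v T c := by
    ext i
    simp only [buyers, Finset.mem_filter, and_congr_right_iff]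
    intro hi
    refine ⟨fun h => lt_of_le_of_lt hcp h, fun h => ?_⟩
    by_contra hcon
    have hmem : v i ∈ C.filter (· ≤ p') := by
      refine Finset.mem_filter.2 ⟨Finset.mem_insert_of_mem (Finset.mem_filter.2
        ⟨Finset.mem_image_of_mem v hi, (hC0 c hcC).trans h.le⟩), not_lt.1 hcon⟩
    exact absurd (hmax _ hmem) (not_le.2 h)
  unfold lottery
  rw [hb]
  refine Finset.expect_le_expect fun W _ => Finset.sum_le_sum fun i _ => ?_
  exact sub_le_sub_left hcp _

end MoneyBurning

end

/-! The only property of `Mye_F` that matters is that the ironed virtual valuation θ is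
nondecreasing (`Prior.ironed_mono`). Suppose k < n and let ℓ be the (k+1)-st highest of the θ(v_i).
By the payment identity, the utility of i is the integral over reports t < v_i of the probability of
being served. This probability is 0 while θ(t) < ℓ, at most k / #{j | ℓ ≤ θ(v_j)} while θ(t) = ℓ,
and never above 1. Hence two lotteries, priced where θ reaches ℓ and where it exceeds ℓ, together
dominate `Mye_F` (`sum_integral_allocProb_le`).

It remains to compare RSOL with a lottery on all agents at a fixed price. Let i be the highest agent
and r the second highest valuation. With constant probability S₁ contains i, S₂ contains the
runner-up, and both hold a constant fraction of the buyers at every price below r: buyer sets form a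
chain, so a union bound over exponential tails is a geometric series (`exists_card_isBalanced`). On
such a sample, integration over price levels moves the surplus of the lottery to S₂, except for v_i
- r, which the Vickrey auction on S₁ recovers. The price p₂ is at least as good on S₂, and balance
carries its lottery from S₂ to S₁ (`lottery_le_of_isBalanced`). -/

noncomputable section

namespace MoneyBurning

/-! ### Monotonicity of the ironed virtual valuation -/

namespace Prior

open MeasureTheory Set Filter Topology

variable (P : Prior)

/-- The probability measure on `ℝ` with density `f`. -/
def law : Measure ℝ := volume.withDensity fun z => ENNReal.ofReal (P.f z)

theorem law_Iic (z : ℝ) : P.law (Iic z) = ENNReal.ofReal (P.F z) := by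
  rw [law, withDensity_apply _ measurableSet_Iic, F,
    ofReal_integral_eq_lintegral_ofReal P.integrable_f.integrableOn
      (ae_of_all _ fun z => P.f_nonneg z)]

instance law_isProbabilityMeasure : IsProbabilityMeasure P.law := by
  constructor
  rw [law, withDensity_apply _ MeasurableSet.univ, setLIntegral_univ,
    ← ofReal_integral_eq_lintegral_ofReal P.integrable_f (ae_of_all _ fun z => P.f_nonneg z),
    P.integral_f, ENNReal.ofReal_one]

theorem F_nonneg (z : ℝ) : 0 ≤ P.F z := setIntegral_nonneg measurableSet_Iic fun _ _ => P.f_nonneg _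

theorem F_eq_cdf (z : ℝ) : P.F z = ProbabilityTheory.cdf P.law z := by
  rw [ProbabilityTheory.cdf_eq_real, measureReal_def, law_Iic, ENNReal.toReal_ofReal (P.F_nonneg z)]

theorem F_le_one (z : ℝ) : P.F z ≤ 1 := by
  rw [F_eq_cdf]; exact ProbabilityTheory.cdf_le_one _ _

theorem F_mono : Monotone P.F := by
  intro a b hab
  rw [F_eq_cdf, F_eq_cdf]; exact ProbabilityTheory.monotone_cdf _ hab

theorem tendsto_F_atTop : Tendsto P.F atTop (𝓝 1) := by
  rw [show P.F = ProbabilityTheory.cdf P.law from funext P.F_eq_cdf]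
  exact ProbabilityTheory.tendsto_cdf_atTop _

theorem F_sub_F (a b : ℝ) : P.F b - P.F a = ∫ x in a..b, P.f x :=
  intervalIntegral.integral_Iic_sub_Iic P.integrable_f.integrableOn P.integrable_f.integrableOn

theorem continuous_F : Continuous P.F := by
  have h : P.F = fun z => P.F 0 + ∫ x in (0 : ℝ)..z, P.f x := by
    funext z; rw [← F_sub_F]; ring
  rw [h]
  exact continuous_const.add
    (intervalIntegral.continuous_primitive (fun a b => P.integrable_f.intervalIntegrable) 0)

theorem F_zero : P.F 0 = 0 := by
  rw [F, integral_Iic_eq_integral_Iio]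
  refine setIntegral_eq_zero_of_forall_eq_zero fun x hx => ?_
  by_contra hne
  exact absurd (P.support_nonneg x (lt_of_le_of_ne (P.f_nonneg x) (Ne.symm hne))) (not_le.2 hx)

/-- `F(z)` is uniformly distributed when `z` is drawn from the prior. -/
theorem map_F_law : P.law.map P.F = volume.restrict (Ioo 0 1) := by
  have : IsFiniteMeasure (P.law.map P.F) := by
    have := Measure.isProbabilityMeasure_map (μ := P.law) P.F_mono.measurable.aemeasurable
    infer_instance
  refine Measure.ext_of_Iic _ _ fun a => ?_
  rw [Measure.map_apply P.F_mono.measurable measurableSet_Iic,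
    Measure.restrict_apply measurableSet_Iic]
  rcases lt_or_ge a 0 with ha | ha
  · have h1 : P.F ⁻¹' Iic a = ∅ := by
      ext z; simpa using ha.trans_le (P.F_nonneg z)
    have h2 : Iic a ∩ Ioo (0 : ℝ) 1 = ∅ := by
      ext z; simp only [mem_inter_iff, mem_Iic, mem_Ioo, mem_empty_iff_false, iff_false]
      intro h; linarith [h.1, h.2.1]
    rw [h1, h2]; simp
  rcases le_or_gt 1 a with ha1 | ha1
  · have h1 : P.F ⁻¹' Iic a = univ := by
      ext z; simpa using (P.F_le_one z).trans ha1
    have h2 : Iic a ∩ Ioo (0 : ℝ) 1 = Ioo 0 1 := by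
      refine inter_eq_right.2 fun z hz => (hz.2.le.trans ha1)
    rw [h1, h2]; simp
  have h2 : Iic a ∩ Ioo (0 : ℝ) 1 = Ioc 0 a := by
    ext z; simp only [mem_inter_iff, mem_Iic, mem_Ioo, mem_Ioc]
    constructor
    · exact fun h => ⟨h.2.1, h.1⟩
    · exact fun h => ⟨h.2, h.1, h.2.trans_lt ha1⟩
  obtain ⟨u, hu⟩ := ((P.tendsto_F_atTop.eventually (eventually_gt_nhds ha1)).exists)
  have hbdd : BddAbove (P.F ⁻¹' Iic a) := by
    refine ⟨u, fun z hz => ?_⟩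
    by_contra hlt
    exact absurd (P.F_mono (not_le.1 hlt).le) (not_le.2 (lt_of_le_of_lt hz hu))
  have hne : (P.F ⁻¹' Iic a).Nonempty := ⟨0, by simpa [P.F_zero] using ha⟩
  have hcl : IsClosed (P.F ⁻¹' Iic a) := isClosed_Iic.preimage P.continuous_F
  have hmem := hcl.csSup_mem hne hbdd
  set s := sSup (P.F ⁻¹' Iic a)
  have hset : P.F ⁻¹' Iic a = Iic s := by
    ext z
    exact ⟨fun hz => le_csSup hbdd hz, fun hz => (P.F_mono hz).trans hmem⟩
  have hFs : P.F s = a := by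
    refine le_antisymm hmem ?_
    refine ge_of_tendsto (P.continuous_F.continuousWithinAt (s := Ioi s) (x := s)) ?_
    filter_upwards [self_mem_nhdsWithin] with z hz
    by_contra hlt
    exact absurd (le_csSup hbdd (not_le.1 hlt).le) (not_le.2 hz)
  rw [hset, law_Iic, hFs, h2, Real.volume_Ioc, sub_zero]

/-- This is where the support being an interval enters: if y < z had the same positive value of `F`,
some support point would lie at or below y, so the density would be positive on all of (y, z) and
that interval would carry mass. -/
theorem quantile_F {z : ℝ} (hz : 0 < P.f z) (hF : 0 < P.F z) : P.quantile (P.F z) = z := by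
  refine IsLeast.csInf_eq ⟨⟨P.support_nonneg z hz, le_rfl⟩, ?_⟩
  rintro y ⟨hy0, hy⟩
  by_contra hlt
  rw [not_le] at hlt
  have hyz : P.F y = P.F z := le_antisymm (P.F_mono hlt.le) hy
  obtain ⟨w, hwy, hw⟩ : ∃ w ≤ y, 0 < P.f w := by
    by_contra hcon
    push Not at hcon
    have : P.F y = 0 := setIntegral_eq_zero_of_forall_eq_zero fun x hx =>
      le_antisymm (hcon x hx) (P.f_nonneg x)
    linarith
  have hpos : 0 < ∫ x in y..z, P.f x := by
    refine intervalIntegral.intervalIntegral_pos_of_pos_on P.integrable_f.intervalIntegrable ?_ hlt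
    intro x hx
    exact P.interval_support.out hw hz ⟨hwy.trans hx.1.le, hx.2.le⟩
  rw [← F_sub_F] at hpos
  linarith

theorem virtualValue_nonneg (z : ℝ) : 0 ≤ P.virtualValue z :=
  div_nonneg (sub_nonneg.2 (P.F_le_one z)) (P.f_nonneg z)

theorem h_nonneg (q : ℝ) : 0 ≤ P.h q := P.virtualValue_nonneg _

theorem H_nonneg {q : ℝ} (hq : 0 ≤ q) : 0 ≤ P.H q :=
  intervalIntegral.integral_nonneg hq fun _ _ => P.h_nonneg _

theorem quantile_monotoneOn : MonotoneOn P.quantile (Ioo 0 1) := by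
  intro a _ b hb hab
  refine csInf_le_csInf ⟨0, fun z hz => hz.1⟩ ?_ fun z hz => ⟨hz.1, hab.trans hz.2⟩
  obtain ⟨u, hu, hu0⟩ := ((P.tendsto_F_atTop.eventually (eventually_gt_nhds hb.2)).and
    (eventually_ge_atTop 0)).exists
  exact ⟨u, hu0, hu.le⟩

theorem aemeasurable_h : AEMeasurable P.h (volume.restrict (Ioo 0 1)) := by
  have hv : Measurable P.virtualValue :=
    (measurable_const.sub P.F_mono.measurable).div P.measurable_f
  exact hv.comp_aemeasurable (aemeasurable_restrict_of_monotoneOn measurableSet_Ioo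
    P.quantile_monotoneOn)

/-- By the change of variables `r = F(z)`, the integral of `h` over `(q, 1)` is the integral of
`1 - F` over `{F > q}`. -/
theorem lintegral_h_le {b q : ℝ} (hb : P.F b = 1) (hq : 0 ≤ q) :
    ∫⁻ r in Ioo q 1, ENNReal.ofReal (P.h r) ≤ ENNReal.ofReal (b * (1 - q)) := by
  have hsub : Ioo q 1 ⊆ Ioo (0 : ℝ) 1 := Ioo_subset_Ioo_left hq
  have hb0 : 0 ≤ b := by
    by_contra hlt
    have := P.F_mono (not_le.1 hlt).le
    rw [P.F_zero, hb] at this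
    linarith
  calc ∫⁻ r in Ioo q 1, ENNReal.ofReal (P.h r)
      = ∫⁻ r, (Ioo q 1).indicator (fun r => ENNReal.ofReal (P.h r)) r ∂(P.law.map P.F) := by
        rw [map_F_law, lintegral_indicator measurableSet_Ioo,
          Measure.restrict_restrict measurableSet_Ioo, inter_eq_left.2 hsub]
    _ ≤ ∫⁻ z, (Ioo q 1).indicator (fun r => ENNReal.ofReal (P.h r)) (P.F z) ∂P.law :=
        lintegral_map_le _ _
    _ ≤ ∫⁻ z, ENNReal.ofReal (P.f z) *
          (Ioo q 1).indicator (fun r => ENNReal.ofReal (P.h r)) (P.F z) :=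
        lintegral_withDensity_le_lintegral_mul _ P.measurable_f.ennreal_ofReal _
    _ ≤ ∫⁻ z, (Icc 0 b).indicator (fun _ => ENNReal.ofReal (1 - q)) z := by
        refine lintegral_mono fun z => ?_
        by_cases hFz : P.F z ∈ Ioo q 1
        swap
        · simp [indicator_of_notMem hFz]
        rw [indicator_of_mem hFz]
        rcases (P.f_nonneg z).eq_or_lt with hf | hf
        · simp [← hf]
        have hzb : z ∈ Icc 0 b := by
          refine ⟨P.support_nonneg z hf, ?_⟩
          by_contra hlt
          have := P.F_mono (not_le.1 hlt).le
          rw [hb] at this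
          linarith [hFz.2]
        rw [indicator_of_mem hzb, ← ENNReal.ofReal_mul hf.le]
        refine ENNReal.ofReal_le_ofReal ?_
        -- The density cancels: f(z) h(F(z)) = 1 - F(z), which is below 1 - q.
        rw [h, P.quantile_F hf (hq.trans_lt hFz.1), virtualValue, mul_div_cancel₀ _ hf.ne']
        linarith [hFz.1]
    _ = ENNReal.ofReal (b * (1 - q)) := by
        rw [lintegral_indicator measurableSet_Icc, setLIntegral_const, Real.volume_Icc, sub_zero,
          ENNReal.ofReal_mul hb0, mul_comm]

theorem integrableOn_h {b : ℝ} (hb : P.F b = 1) : IntegrableOn P.h (Ioo 0 1) := by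
  refine ⟨P.aemeasurable_h.aestronglyMeasurable, ?_⟩
  rw [hasFiniteIntegral_iff_ofReal (ae_of_all _ fun r => P.h_nonneg r)]
  exact (P.lintegral_h_le hb le_rfl).trans_lt ENNReal.ofReal_lt_top

theorem intervalIntegrable_h {b q r : ℝ} (hb : P.F b = 1) (hq : 0 ≤ q) (hqr : q ≤ r) (hr : r ≤ 1) :
    IntervalIntegrable P.h volume q r := by
  rw [intervalIntegrable_iff_integrableOn_Ioo_of_le hqr]
  exact (P.integrableOn_h hb).mono_set (Ioo_subset_Ioo hq hr)

theorem H_one_sub_H {b q : ℝ} (hb : P.F b = 1) (hq : 0 ≤ q) (hq1 : q ≤ 1) :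
    P.H 1 - P.H q = ∫ r in q..1, P.h r := by
  rw [H, H, intervalIntegral.integral_interval_sub_left
    (P.intervalIntegrable_h hb le_rfl zero_le_one le_rfl)
    (P.intervalIntegrable_h hb le_rfl hq hq1)]

theorem H_le_H_one {b q : ℝ} (hb : P.F b = 1) (hq : 0 ≤ q) (hq1 : q ≤ 1) : P.H q ≤ P.H 1 := by
  have := intervalIntegral.integral_nonneg (μ := volume) hq1 fun r _ => P.h_nonneg r
  linarith [P.H_one_sub_H hb hq hq1]

theorem H_one_sub_H_le {b q : ℝ} (hb : P.F b = 1) (hq : 0 ≤ q) (hq1 : q ≤ 1) :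
    P.H 1 - P.H q ≤ b * (1 - q) := by
  have hb0 : 0 ≤ b := by
    by_contra hlt
    have := P.F_mono (not_le.1 hlt).le
    rw [P.F_zero, hb] at this
    linarith
  rw [P.H_one_sub_H hb hq hq1, intervalIntegral.integral_of_le hq1, integral_Ioc_eq_integral_Ioo,
    integral_eq_lintegral_of_nonneg_ae (ae_of_all _ fun r => P.h_nonneg r)
      (P.aemeasurable_h.mono_measure (Measure.restrict_mono (Ioo_subset_Ioo_left hq)
        le_rfl)).aestronglyMeasurable]
  exact ENNReal.toReal_le_of_le_ofReal (mul_nonneg hb0 (sub_nonneg.2 hq1)) (P.lintegral_h_le hb hq)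

theorem le_G {φ : ℝ → ℝ} (hφ : ConvexOn ℝ (Ico 0 1) φ) (hle : ∀ r ∈ Ico (0 : ℝ) 1, φ r ≤ P.H r)
    {q : ℝ} (hq : q ∈ Ico (0 : ℝ) 1) : φ q ≤ P.G q := by
  refine le_csSup ⟨P.H q, ?_⟩ ⟨φ, hφ, hle, rfl⟩
  rintro y ⟨ψ, -, h, rfl⟩
  exact h q hq

theorem G_nonneg {q : ℝ} (hq : q ∈ Ico (0 : ℝ) 1) : 0 ≤ P.G q :=
  P.le_G (φ := fun _ => 0) (convexOn_const 0 (convex_Ico 0 1)) (fun _ hr => P.H_nonneg hr.1) hq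

theorem G_le {q y : ℝ} (h : ∀ φ : ℝ → ℝ, ConvexOn ℝ (Ico 0 1) φ →
    (∀ r ∈ Ico (0 : ℝ) 1, φ r ≤ P.H r) → φ q ≤ y) : P.G q ≤ y := by
  refine csSup_le ⟨0, fun _ => 0, convexOn_const 0 (convex_Ico 0 1), fun _ hr => P.H_nonneg hr.1,
    rfl⟩ ?_
  rintro y ⟨ψ, hψ, hle, rfl⟩
  exact h ψ hψ hle

theorem G_le_H {q : ℝ} (hq : q ∈ Ico (0 : ℝ) 1) : P.G q ≤ P.H q :=
  P.G_le fun _ _ h => h q hq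

theorem G_zero : P.G 0 = 0 := by
  refine le_antisymm ((P.G_le_H ⟨le_rfl, one_pos⟩).trans ?_) (P.G_nonneg ⟨le_rfl, one_pos⟩)
  simp [H]

theorem convexOn_G : ConvexOn ℝ (Ico 0 1) P.G := by
  refine ⟨convex_Ico 0 1, fun x hx y hy a b ha hb hab => P.G_le fun φ hφ hle => ?_⟩
  refine (hφ.2 hx hy ha hb hab).trans ?_
  simp only [smul_eq_mul]
  gcongr
  · exact P.le_G hφ hle hx
  · exact P.le_G hφ hle hy

/-- `G` is convex, nonnegative and vanishes at 0, so it cannot decrease. The bound keeps the right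
derivative finite even at the endpoint 0, where convexity alone would allow slope -∞. -/
theorem G_slope_nonneg {q r : ℝ} (hq : 0 ≤ q) (hqr : q < r) (hr : r < 1) : 0 ≤ slope P.G q r := by
  rw [slope_def_field]
  have hr0 : 0 < r := hq.trans_lt hqr
  rcases hq.eq_or_lt with rfl | hq
  · rw [P.G_zero]
    exact div_nonneg (by linarith [P.G_nonneg ⟨hr0.le, hr⟩]) (by linarith)
  refine le_trans ?_ (P.convexOn_G.slope_mono_adjacent ⟨le_rfl, one_pos⟩ ⟨hr0.le, hr⟩ hq hqr)
  rw [P.G_zero]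
  exact div_nonneg (by linarith [P.G_nonneg ⟨hq.le, hqr.trans hr⟩]) (by linarith)

theorem G_hasDerivWithinAt {q : ℝ} (hq : q ∈ Ico (0 : ℝ) 1) :
    HasDerivWithinAt P.G (P.g q) (Ici q) q := by
  have hd : DifferentiableWithinAt ℝ P.G (Ici q) q := by
    have : HasDerivWithinAt P.G (sInf (slope P.G q '' Ioo q 1)) (Ioi q) q := by
      rw [hasDerivWithinAt_iff_tendsto_slope' self_notMem_Ioi]
      refine MonotoneOn.tendsto_nhdsWithin_Ioo_right (nonempty_Ioo.2 hq.2) ?_ ?_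
      · refine (P.convexOn_G.slope_mono hq).mono fun r hr => ?_
        exact ⟨⟨hq.1.trans hr.1.le, hr.2⟩, hr.1.ne'⟩
      · refine ⟨0, ?_⟩
        rintro _ ⟨r, hr, rfl⟩
        exact P.G_slope_nonneg hq.1 hr.1 hr.2
    exact this.Ici_of_Ioi.differentiableWithinAt
  rw [g, if_pos hq.2]
  exact hd.hasDerivWithinAt

theorem g_le_slope {q r : ℝ} (hq : 0 ≤ q) (hqr : q < r) (hr : r < 1) : P.g q ≤ slope P.G q r :=
  P.convexOn_G.le_slope_of_hasDerivWithinAt_Ioi ⟨hq, hqr.trans hr⟩ ⟨hq.trans hqr.le, hr⟩ hqr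
    (P.G_hasDerivWithinAt ⟨hq, hqr.trans hr⟩).Ioi_of_Ici

theorem le_g {q y : ℝ} (hq : q ∈ Ico (0 : ℝ) 1) (h : ∀ r, q < r → r < 1 → y ≤ slope P.G q r) :
    y ≤ P.g q := by
  refine ge_of_tendsto ((hasDerivWithinAt_iff_tendsto_slope' self_notMem_Ioi).1
    (P.G_hasDerivWithinAt hq).Ioi_of_Ici) ?_
  filter_upwards [Ioo_mem_nhdsGT hq.2] with r hr
  exact h r hr.1 hr.2

theorem g_monotoneOn : MonotoneOn P.g (Ico 0 1) := by
  intro q hq r hr hqr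
  rcases hqr.eq_or_lt with rfl | hqr
  · exact le_rfl
  refine P.le_g hr fun s hs hs1 => (P.g_le_slope hq.1 hqr hr.2).trans ?_
  rw [slope_def_field, slope_def_field]
  exact P.convexOn_G.slope_mono_adjacent hq ⟨hr.1.trans hs.le, hs1⟩ hqr hs

theorem g_one : P.g 1 = sSup (P.g '' Ico 0 1) := by
  rw [g, if_neg (lt_irrefl _)]
  congr 1
  refine image_congr fun r hr => ?_
  rw [g, if_pos hr.2]

/-- If the support is bounded, then `G` is Lipschitz up to `1`, because a line is a minorant of
`H`. -/
theorem bddAbove_g {b : ℝ} (hb : P.F b = 1) : BddAbove (P.g '' Ico 0 1) := by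
  refine ⟨2 * b, ?_⟩
  rintro _ ⟨q, hq, rfl⟩
  have hline : P.H 1 - b * (1 - q) ≤ P.G q := by
    refine P.le_G (φ := fun r => P.H 1 - b * (1 - r)) ?_ ?_ hq
    · refine ⟨convex_Ico 0 1, fun x _ y _ s t _ _ hst => le_of_eq ?_⟩
      simp only [smul_eq_mul]
      linear_combination (b - P.H 1) * hst
    · intro r hr
      linarith [P.H_one_sub_H_le hb hr.1 hr.2.le]
  -- The chord from q to the midpoint of [q, 1] rises by at most b(1 - q) over a length (1 - q)/2,
  -- whence the bound 2b.
  have hr : q < (q + 1) / 2 ∧ (q + 1) / 2 < 1 := by constructor <;> linarith [hq.2]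
  refine (P.g_le_slope hq.1 hr.1 hr.2).trans ?_
  have hG := (P.G_le_H ⟨hq.1.trans hr.1.le, hr.2⟩).trans
    (P.H_le_H_one hb (hq.1.trans hr.1.le) hr.2.le)
  rw [slope_def_field, div_le_iff₀ (by linarith)]
  linarith

/-- Below 1 this is convexity of `G`. The value 1 of `F` is attained only for bounded support; then
`g` is bounded, so the supremum defining `g 1` is a genuine one and not a default value. -/
theorem ironed_mono : Monotone P.ironed := by
  intro y z hyz
  rw [ironed, ironed]
  rcases (P.F_le_one z).lt_or_eq with hz | hz
  · exact P.g_monotoneOn ⟨P.F_nonneg y, (P.F_mono hyz).trans_lt hz⟩ ⟨P.F_nonneg z, hz⟩ (P.F_mono hyz)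
  rcases (P.F_le_one y).lt_or_eq with hy | hy
  · rw [hz, g_one]
    exact le_csSup (P.bddAbove_g hz) ⟨_, ⟨P.F_nonneg y, hy⟩, rfl⟩
  · rw [hy, hz]

end Prior

end MoneyBurning

namespace MoneyBurning

open Finset

/-! ### Lotteries in closed form -/

section Symmetry

variable {α : Type*} [DecidableEq α]

/-- In a uniformly random member of a family invariant under the transpositions of `B`, all elements
of `B` are equally likely. -/
theorem card_mul_expect_mem {𝒜 : Finset (Finset α)} {B : Finset α}
    (h𝒜 : ∀ i ∈ B, ∀ j ∈ B, ∀ A ∈ 𝒜, A.map (Equiv.swap i j).toEmbedding ∈ 𝒜) {i : α} (hi : i ∈ B) :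
    (#B : ℝ) * (𝔼 A ∈ 𝒜, if i ∈ A then (1 : ℝ) else 0) = 𝔼 A ∈ 𝒜, (#(B ∩ A) : ℝ) := by
  have hsymm : ∀ j ∈ B, (𝔼 A ∈ 𝒜, if j ∈ A then (1 : ℝ) else 0) =
      𝔼 A ∈ 𝒜, if i ∈ A then (1 : ℝ) else 0 := by
    intro j hj
    have hinv : ∀ A : Finset α, (A.map (Equiv.swap i j).toEmbedding).map
        (Equiv.swap i j).toEmbedding = A := by
      intro A
      ext x
      simp [Finset.mem_map_equiv]
    refine Finset.expect_nbij' (fun A => A.map (Equiv.swap i j).toEmbedding)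
      (fun A => A.map (Equiv.swap i j).toEmbedding) (h𝒜 i hi j hj) (h𝒜 i hi j hj)
      (fun A _ => hinv A) (fun A _ => hinv A) fun A _ => ?_
    simp [Finset.mem_map_equiv]
  calc (#B : ℝ) * (𝔼 A ∈ 𝒜, if i ∈ A then (1 : ℝ) else 0)
      = ∑ j ∈ B, 𝔼 A ∈ 𝒜, if j ∈ A then (1 : ℝ) else 0 := by
        rw [Finset.sum_congr rfl hsymm, sum_const, nsmul_eq_mul]
    _ = 𝔼 A ∈ 𝒜, (#(B ∩ A) : ℝ) := by
        rw [← Finset.expect_sum_comm]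
        simp

end Symmetry

variable {n : ℕ}

/-- The total excess of the valuations in `T` over the price `p`. -/
def excess (v : Fin n → ℝ) (T : Finset (Fin n)) (p : ℝ) : ℝ := ∑ i ∈ T, max (v i - p) 0

theorem excess_nonneg (v : Fin n → ℝ) (T : Finset (Fin n)) (p : ℝ) : 0 ≤ excess v T p :=
  sum_nonneg fun _ _ => le_max_right _ _

theorem excess_mono (v : Fin n → ℝ) {T U : Finset (Fin n)} (h : T ⊆ U) (p : ℝ) :
    excess v T p ≤ excess v U p :=
  sum_le_sum_of_subset_of_nonneg h fun _ _ _ => le_max_right _ _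

theorem sum_buyers (v : Fin n → ℝ) (T : Finset (Fin n)) (p : ℝ) :
    ∑ i ∈ buyers v T p, (v i - p) = excess v T p := by
  rw [excess, buyers, sum_filter]
  refine sum_congr rfl fun i _ => ?_
  split_ifs with h
  · rw [max_eq_left (by linarith)]
  · rw [max_eq_right (by linarith)]

/-- By symmetry each of the b buyers wins with probability min(k, b)/b. With no buyers both sides
vanish, 0/0 being 0. -/
theorem lottery_eq (k : ℕ) (v : Fin n → ℝ) (T : Finset (Fin n)) (p : ℝ) :
    lottery k v T p = (min k #(buyers v T p) : ℕ) / (#(buyers v T p) : ℝ) * excess v T p := by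
  rw [← sum_buyers, lottery]
  set B := buyers v T p
  set m := min k #B
  have hmB : m ≤ #B := min_le_right _ _
  have hne : (B.powersetCard m).Nonempty := powersetCard_nonempty.2 hmB
  have h1 : ∀ W ∈ B.powersetCard m, ∑ i ∈ W, (v i - p) =
      ∑ i ∈ B, (if i ∈ W then (1 : ℝ) else 0) * (v i - p) := by
    intro W hW
    have hWB := (mem_powersetCard.1 hW).1
    simp only [ite_mul, one_mul, zero_mul]
    rw [← sum_filter, filter_mem_eq_inter, inter_eq_right.2 hWB]
  rw [expect_congr rfl h1, expect_sum_comm, mul_sum]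
  refine sum_congr rfl fun i hi => ?_
  rw [← expect_mul]
  congr 1
  have hpos : (0 : ℝ) < #B := by exact_mod_cast card_pos.2 ⟨i, hi⟩
  rw [eq_div_iff hpos.ne', mul_comm, card_mul_expect_mem ?_ hi]
  · rw [expect_congr rfl (g := fun _ => (m : ℝ)), expect_const hne]
    intro W hW
    rw [inter_eq_right.2 (mem_powersetCard.1 hW).1, (mem_powersetCard.1 hW).2]
  · intro a ha b hb A hA
    rw [mem_powersetCard] at hA ⊢
    refine ⟨fun x hx => ?_, by rw [card_map]; exact hA.2⟩
    rw [mem_map_equiv, Equiv.symm_swap] at hx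
    by_cases hxa : x = a
    · rwa [hxa]
    by_cases hxb : x = b
    · rwa [hxb]
    rw [Equiv.swap_apply_of_ne_of_ne hxa hxb] at hx
    exact hA.1 hx

theorem lottery_nonneg (k : ℕ) (v : Fin n → ℝ) (T : Finset (Fin n)) (p : ℝ) :
    0 ≤ lottery k v T p := by
  rw [lottery_eq]
  exact mul_nonneg (by positivity) (excess_nonneg _ _ _)

theorem excess_eq_zero {v : Fin n → ℝ} {T : Finset (Fin n)} {p : ℝ} (h : buyers v T p = ∅) :
    excess v T p = 0 := by
  rw [← sum_buyers, h, sum_empty]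

/-- A lottery serves every buyer with probability at least `k / m` if there are at most `m ≥ k`
buyers. -/
theorem div_mul_excess_le_lottery {k m : ℕ} {v : Fin n → ℝ} {T : Finset (Fin n)} {p : ℝ}
    (hkm : k ≤ m) (hm : #(buyers v T p) ≤ m) :
    (k : ℝ) / m * excess v T p ≤ lottery k v T p := by
  rw [lottery_eq]
  rcases (buyers v T p).eq_empty_or_nonempty with h | h
  · simp [excess_eq_zero h]
  refine mul_le_mul_of_nonneg_right ?_ (excess_nonneg _ _ _)
  have hb : 0 < #(buyers v T p) := card_pos.2 h
  rw [div_le_div_iff₀ (by exact_mod_cast hb.trans_le hm) (by exact_mod_cast hb)]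
  rcases le_total k #(buyers v T p) with hk | hk
  · rw [min_eq_left hk]
    gcongr
  · rw [min_eq_right hk, mul_comm]
    gcongr

theorem excess_le_lottery {k : ℕ} {v : Fin n → ℝ} {T : Finset (Fin n)} {p : ℝ}
    (h : #(buyers v T p) ≤ k) : excess v T p ≤ lottery k v T p := by
  rcases k.eq_zero_or_pos with rfl | hk
  · rw [excess_eq_zero (card_eq_zero.1 (Nat.le_zero.1 h))]
    exact lottery_nonneg _ _ _ _
  · have := div_mul_excess_le_lottery le_rfl h
    rwa [div_self (by exact_mod_cast hk.ne'), one_mul] at this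

/-! ### Allocation probabilities and utilities -/

section Allocation

variable (k : ℕ) (θ : ℝ → ℝ) (v : Fin n → ℝ) (i : Fin n)

theorem allocProb_nonneg : 0 ≤ allocProb k θ v i :=
  expect_nonneg fun A _ => by split_ifs <;> norm_num

theorem optAllocations_nonempty : (optAllocations k θ v).Nonempty := by
  obtain ⟨A, hA, hmax⟩ := exists_max_image (univ.filter fun A : Finset (Fin n) => #A ≤ k)
    (fun A => ∑ i ∈ A, θ (v i)) ⟨∅, by simp⟩
  refine ⟨A, ?_⟩
  simp only [optAllocations, mem_filter, mem_univ, true_and] at hA hmax ⊢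
  exact ⟨hA, hmax⟩

theorem allocProb_le_one : allocProb k θ v i ≤ 1 := by
  refine (expect_le_expect (g := fun _ => (1 : ℝ)) fun A _ => ?_).trans_eq
    (expect_const (optAllocations_nonempty k θ v) 1)
  split_ifs <;> norm_num

variable {k θ v}

/-- An optimal allocation leaves to an indifference class at most the units that remain after all
agents above it have been served. -/
theorem card_level_inter_le {A : Finset (Fin n)} (hA : A ∈ optAllocations k θ v) (ℓ : ℝ) :
    #((univ.filter fun j => θ (v j) = ℓ) ∩ A) ≤ k - #{j | ℓ < θ (v j)} := by
  simp only [optAllocations, mem_filter, mem_univ, true_and] at hA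
  obtain ⟨hcard, hmax⟩ := hA
  by_contra hlt
  obtain ⟨i, hi⟩ : ((univ.filter fun j => θ (v j) = ℓ) ∩ A).Nonempty := card_pos.1 (by omega)
  simp only [mem_inter, mem_filter, mem_univ, true_and] at hi
  -- If all agents above ℓ were served, too many units would be used. So some such agent j is
  -- unserved, and exchanging i for j improves the objective at equal cardinality, whatever the
  -- signs of `θ`.
  have hsub : ¬ ({j | ℓ < θ (v j)} : Finset (Fin n)) ⊆ A := by
    intro hsub
    have hdisj : Disjoint ({j | ℓ < θ (v j)} : Finset (Fin n)) ((univ.filter fun j => θ (v j) = ℓ) ∩ A) := by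
      rw [disjoint_left]
      intro j hj hj'
      simp only [mem_inter, mem_filter, mem_univ, true_and] at hj hj'
      exact hj.ne' hj'.1
    have := card_le_card (union_subset hsub
      (inter_subset_right (s₁ := univ.filter fun j => θ (v j) = ℓ) (s₂ := A)))
    rw [card_union_of_disjoint hdisj] at this
    omega
  obtain ⟨j, hj, hjA⟩ := not_subset.1 hsub
  simp only [mem_filter, mem_univ, true_and] at hj
  have hjE : j ∉ A.erase i := fun h => hjA (mem_of_mem_erase h)
  have := hmax (insert j (A.erase i)) (by
    rw [card_insert_of_notMem hjE, card_erase_of_mem hi.2]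
    have := card_pos.2 ⟨i, hi.2⟩
    omega)
  rw [sum_insert hjE] at this
  have h2 := add_sum_erase A (fun j => θ (v j)) hi.2
  linarith [hi.1]

theorem map_swap_mem_optAllocations {A : Finset (Fin n)} (hA : A ∈ optAllocations k θ v)
    {i j : Fin n} (hij : θ (v i) = θ (v j)) :
    A.map (Equiv.swap i j).toEmbedding ∈ optAllocations k θ v := by
  simp only [optAllocations, mem_filter, mem_univ, true_and] at hA ⊢
  refine ⟨by rw [card_map]; exact hA.1, fun B hB => (hA.2 B hB).trans_eq ?_⟩
  rw [sum_map]
  refine sum_congr rfl fun x _ => ?_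
  simp only [Equiv.coe_toEmbedding]
  by_cases hxi : x = i
  · rw [hxi, Equiv.swap_apply_left, hij]
  by_cases hxj : x = j
  · rw [hxj, Equiv.swap_apply_right, hij]
  rw [Equiv.swap_apply_of_ne_of_ne hxi hxj]

/-- Optimality is preserved by transposing indifferent agents, so a class shares equally the units
left by those above it. Truncated subtraction covers the case where nothing is left. -/
theorem card_level_mul_allocProb_le :
    (#{j | θ (v j) = θ (v i)} : ℝ) * allocProb k θ v i ≤
      (k - #{j | θ (v i) < θ (v j)} : ℕ) := by
  rw [allocProb, card_mul_expect_mem ?_ (by simp)]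
  · refine (expect_le_expect fun A hA => ?_).trans_eq
      (expect_const (optAllocations_nonempty k θ v) _)
    exact_mod_cast card_level_inter_le hA _
  · intro a ha b hb A hA
    simp only [mem_filter, mem_univ, true_and] at ha hb
    exact map_swap_mem_optAllocations hA (ha.trans hb.symm)

theorem allocProb_eq_zero (h : k ≤ #{j | θ (v i) < θ (v j)}) : allocProb k θ v i = 0 := by
  have h1 := card_level_mul_allocProb_le (k := k) (θ := θ) (v := v) i
  rw [Nat.sub_eq_zero_of_le h] at h1
  have h2 : (0 : ℝ) < #{j | θ (v j) = θ (v i)} := by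
    exact_mod_cast card_pos.2 ⟨i, by simp⟩
  refine le_antisymm ?_ (allocProb_nonneg _ _ _ _)
  by_contra hlt
  have := mul_pos h2 (not_le.1 hlt)
  simp at h1
  linarith

end Allocation

/-- The expected residual surplus is the sum of the expected utilities, given by the payment
identity. -/
theorem mye_le (k : ℕ) (P : Prior) {v : Fin n → ℝ} (hv : ∀ i, 0 ≤ v i) :
    mye k P v ≤ ∑ i, ∫ t in (0 : ℝ)..v i, allocProb k P.ironed (Function.update v i t) i := by
  have h1 : ∀ A ∈ optAllocations k P.ironed v,
      ∑ i ∈ A, (v i - payment k P.ironed v i / allocProb k P.ironed v i) =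
      ∑ i, (if i ∈ A then (1 : ℝ) else 0) *
        (v i - payment k P.ironed v i / allocProb k P.ironed v i) := by
    intro A _
    simp only [ite_mul, one_mul, zero_mul]
    rw [← sum_filter, filter_mem_eq_inter, univ_inter]
  rw [mye, expect_congr rfl h1, expect_sum_comm]
  refine sum_le_sum fun i _ => ?_
  rw [← expect_mul]
  change allocProb k P.ironed v i * _ ≤ _
  -- An agent who never wins contributes 0 to the surplus, while the payment-identity integral is
  -- still nonnegative; hence an inequality.
  rcases (allocProb_nonneg k P.ironed v i).eq_or_lt with hx | hx
  · rw [← hx, zero_mul]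
    exact intervalIntegral.integral_nonneg (hv i) fun t _ => allocProb_nonneg _ _ _ _
  · rw [mul_sub, mul_div_cancel₀ _ hx.ne', payment]
    linarith

theorem integral_indicator_Ici {a u : ℝ} (ha : 0 ≤ a) (hu : 0 ≤ u) :
    ∫ t in (0 : ℝ)..u, (Set.Ici a).indicator (fun _ => (1 : ℝ)) t = max (u - a) 0 := by
  rw [intervalIntegral.integral_of_le hu, MeasureTheory.integral_Ioc_eq_integral_Ioo,
    MeasureTheory.setIntegral_indicator measurableSet_Ici,
    MeasureTheory.setIntegral_const, smul_eq_mul, mul_one]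
  rcases ha.eq_or_lt with rfl | ha
  · have : Set.Ioo 0 u ∩ Set.Ici 0 = Set.Ioo 0 u :=
      Set.inter_eq_left.2 fun t ht => ht.1.le
    rw [this, Real.volume_real_Ioo]
  · have : Set.Ioo 0 u ∩ Set.Ici a = Set.Ico a u := by
      ext t
      simp only [Set.mem_inter_iff, Set.mem_Ioo, Set.mem_Ici, Set.mem_Ico]
      exact ⟨fun h => ⟨h.2, h.1.2⟩, fun h => ⟨⟨ha.trans_le h.1, h.2⟩, h.1⟩⟩
    rw [this, Real.volume_real_Ico]

theorem intervalIntegrable_indicator_Ici (a b c : ℝ) :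
    IntervalIntegrable ((Set.Ici a).indicator fun _ => (1 : ℝ)) MeasureTheory.volume b c := by
  refine (Monotone.intervalIntegrable fun s t hst => ?_)
  by_cases hs : a ≤ s
  · rw [Set.indicator_of_mem (show s ∈ Set.Ici a from hs),
      Set.indicator_of_mem (show t ∈ Set.Ici a from hs.trans hst)]
  · rw [Set.indicator_of_notMem (show s ∉ Set.Ici a from hs)]
    exact Set.indicator_nonneg (fun _ _ => zero_le_one) _

theorem integral_le_of_le_step {x : ℝ → ℝ} {c p q u : ℝ} (hc : 0 ≤ c) (hp : 0 ≤ p) (hq : 0 ≤ q)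
    (hu : 0 ≤ u) (h0 : ∀ t, 0 ≤ t → t < u → t < q → x t ≤ 0)
    (hcx : ∀ t, 0 ≤ t → t < u → t < p → x t ≤ c) (h1 : ∀ t, x t ≤ 1) :
    ∫ t in (0 : ℝ)..u, x t ≤ c * max (u - q) 0 + max (u - p) 0 := by
  -- No regularity of x is needed: a non-integrable function has integral 0 by convention.
  by_cases hx : IntervalIntegrable x MeasureTheory.volume 0 u
  swap
  · rw [intervalIntegral.integral_undef hx]
    positivity
  rw [← integral_indicator_Ici hq hu, ← integral_indicator_Ici hp hu,
    ← intervalIntegral.integral_const_mul, ← intervalIntegral.integral_add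
      ((intervalIntegrable_indicator_Ici q 0 u).const_mul c)
      (intervalIntegrable_indicator_Ici p 0 u)]
  refine intervalIntegral.integral_mono_on_of_le_Ioo hu hx
    (((intervalIntegrable_indicator_Ici q 0 u).const_mul c).add
      (intervalIntegrable_indicator_Ici p 0 u)) fun t ht => ?_
  have hi0 : ∀ a : ℝ, 0 ≤ (Set.Ici a).indicator (fun _ => (1 : ℝ)) t := fun a =>
    Set.indicator_nonneg (fun _ _ => zero_le_one) _
  by_cases htq : t < q
  · exact (h0 t ht.1.le ht.2 htq).trans (add_nonneg (mul_nonneg hc (hi0 q)) (hi0 p))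
  rw [Set.indicator_of_mem (show t ∈ Set.Ici q from not_lt.1 htq)]
  by_cases htp : t < p
  · linarith [hcx t ht.1.le ht.2 htp, hi0 p]
  · rw [Set.indicator_of_mem (show t ∈ Set.Ici p from not_lt.1 htp)]
    linarith [h1 t]

/-- The cutoff is the infimum of the upper set within [0, ∞). Buying requires a valuation strictly
above the price, so it is irrelevant whether the infimum is attained. -/
theorem exists_cutoff {v : Fin n → ℝ} (hv : ∀ i, 0 ≤ v i) {D : Set ℝ}
    (hD : ∀ s ∈ D, ∀ t, s ≤ t → t ∈ D) :
    ∃ p, 0 ≤ p ∧ (∀ t, 0 ≤ t → t < p → t ∉ D) ∧ ∀ i, p < v i → v i ∈ D := by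
  rcases (D ∩ Set.Ici 0).eq_empty_or_nonempty with he | hne
  -- No valuation exceeds the sum of all, so at this price nobody buys.
  · refine ⟨∑ i, v i, sum_nonneg fun i _ => hv i, fun t ht _ htD => ?_, fun i hi => ?_⟩
    · exact Set.notMem_empty t (he ▸ ⟨htD, ht⟩)
    · exact absurd (single_le_sum (fun j _ => hv j) (mem_univ i)) (not_le.2 hi)
  · have hbdd : BddBelow (D ∩ Set.Ici 0) := ⟨0, fun t ht => ht.2⟩
    refine ⟨sInf (D ∩ Set.Ici 0), le_csInf hne fun t ht => ht.2, fun t ht htp htD => ?_,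
      fun i hi => ?_⟩
    · exact absurd (csInf_le hbdd ⟨htD, ht⟩) (not_le.2 htp)
    · obtain ⟨z, hz, hzi⟩ := exists_lt_of_csInf_lt hne hi
      exact hD z hz.1 _ hzi.le

/-- The `(k+1)`-st highest value of a function on agents. -/
theorem exists_critical_level {k : ℕ} (hk : k < n) (w : Fin n → ℝ) :
    ∃ ℓ, #{j | ℓ < w j} ≤ k ∧ k < #{j | ℓ ≤ w j} := by
  have hn : (univ : Finset (Fin n)).Nonempty := card_pos.1 (by rw [card_fin]; omega)
  obtain ⟨j₀, -, hj₀⟩ := exists_min_image univ w hn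
  have hJ : (univ.filter fun j => k < #{m | w j ≤ w m}).Nonempty := by
    refine ⟨j₀, mem_filter.2 ⟨mem_univ _, ?_⟩⟩
    rw [filter_true_of_mem fun m hm => hj₀ m hm, card_fin]
    exact hk
  obtain ⟨j, hj, hmax⟩ := exists_max_image _ w hJ
  refine ⟨w j, ?_, (mem_filter.1 hj).2⟩
  -- `w j` is the largest value with more than k agents at or above it; were more than k strictly
  -- above, the least of those would be a larger such value.
  by_contra hlt
  rw [not_le] at hlt
  obtain ⟨i, hi, hmin⟩ := exists_min_image (univ.filter fun m => w j < w m) w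
    (card_pos.1 (by omega))
  have hiJ : i ∈ univ.filter fun j => k < #{m | w j ≤ w m} := by
    refine mem_filter.2 ⟨mem_univ _, hlt.trans_le (card_le_card fun m hm => ?_)⟩
    exact mem_filter.2 ⟨mem_univ _, hmin m hm⟩
  exact absurd (hmax i hiJ) (not_le.2 (mem_filter.1 hi).2)

/-! ### Domination by two lotteries -/

section Update

variable {k : ℕ} {θ : ℝ → ℝ} {v : Fin n → ℝ} {ℓ : ℝ}

/-- Even without i, at least k agents remain at level ℓ or higher, all strictly above the report t.
-/
theorem allocProb_update_eq_zero (hk : k < #{j | ℓ ≤ θ (v j)}) (i : Fin n) {t : ℝ}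
    (ht : θ t < ℓ) : allocProb k θ (Function.update v i t) i = 0 := by
  refine allocProb_eq_zero i ?_
  have hsub : ({j | ℓ ≤ θ (v j)} : Finset (Fin n)).erase i ⊆
      univ.filter fun j => θ (Function.update v i t i) < θ (Function.update v i t j) := by
    intro j hj
    rw [mem_erase, mem_filter] at hj
    rw [mem_filter, Function.update_self, Function.update_of_ne hj.1]
    exact ⟨mem_univ _, ht.trans_le hj.2.2⟩
  have := card_le_card hsub
  have := pred_card_le_card_erase (s := ({j | ℓ ≤ θ (v j)} : Finset (Fin n))) (a := i)
  omega

theorem card_level_add (θ : ℝ → ℝ) (v : Fin n → ℝ) (ℓ : ℝ) :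
    #{j | ℓ < θ (v j)} + #{j | θ (v j) = ℓ} = #{j | ℓ ≤ θ (v j)} := by
  rw [← card_union_of_disjoint]
  · congr 1
    ext j
    simp only [mem_union, mem_filter, mem_univ, true_and]
    rw [le_iff_lt_or_eq, eq_comm (a := ℓ)]
  · rw [disjoint_left]
    intro j hj hj'
    simp only [mem_filter, mem_univ, true_and] at hj hj'
    exact hj.ne' hj'

/-- With s agents above ℓ and m at ℓ, an agent at ℓ is served with probability at most (k - s)/m,
which is at most k/(s + m) since k ≤ s + m. An agent lowered from above to ℓ turns (s, m) into (s -
1, m + 1) and leaves the sum unchanged. -/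
theorem allocProb_update_level_le (hs : #{j | ℓ < θ (v j)} ≤ k) (hk : k < #{j | ℓ ≤ θ (v j)})
    {i : Fin n} (hi : ℓ ≤ θ (v i)) {t : ℝ} (ht : θ t = ℓ) :
    allocProb k θ (Function.update v i t) i ≤ k / #{j | ℓ ≤ θ (v j)} := by
  have hmain := card_level_mul_allocProb_le (k := k) (θ := θ) (v := Function.update v i t) i
  have hx := allocProb_nonneg k θ (Function.update v i t) i
  set x := allocProb k θ (Function.update v i t) i
  have hadd := card_level_add θ v ℓ
  rw [le_div_iff₀ (by exact_mod_cast (Nat.zero_le k).trans_lt hk)]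
  rcases hi.eq_or_lt with hi | hi
  · have h1 : (univ.filter fun j => θ (Function.update v i t j) =
        θ (Function.update v i t i)) = univ.filter fun j => θ (v j) = ℓ := by
      ext j
      simp only [mem_filter, mem_univ, true_and, Function.update_self, ht]
      by_cases hj : j = i
      · rw [hj, Function.update_self, ht, hi]
      · rw [Function.update_of_ne hj]
    have h2 : (univ.filter fun j => θ (Function.update v i t i) <
        θ (Function.update v i t j)) = univ.filter fun j => ℓ < θ (v j) := by
      ext j
      simp only [mem_filter, mem_univ, true_and, Function.update_self, ht]
      by_cases hj : j = i
      · rw [hj, Function.update_self, ht, ← hi]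
      · rw [Function.update_of_ne hj]
    rw [h1, h2] at hmain
    set s := #{j | ℓ < θ (v j)}
    set m := #{j | θ (v j) = ℓ}
    rw [← hadd] at hk ⊢
    rw [Nat.cast_sub hs] at hmain
    have hs' : (s : ℝ) ≤ k := by exact_mod_cast hs
    have hk' : (k : ℝ) < s + m := by exact_mod_cast hk
    have hm0 : (0 : ℝ) < m := by linarith
    have hs0 : (0 : ℝ) ≤ s := by positivity
    push_cast
    have h3 : (s : ℝ) * (m * x) ≤ s * m := by nlinarith
    have h4 : m * (x * (s + m)) ≤ m * k := by nlinarith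
    exact le_of_mul_le_mul_left h4 hm0
  · have h1 : (univ.filter fun j => θ (Function.update v i t j) =
        θ (Function.update v i t i)) = insert i (univ.filter fun j => θ (v j) = ℓ) := by
      ext j
      simp only [mem_filter, mem_univ, true_and, Function.update_self, ht, mem_insert]
      by_cases hj : j = i
      · simp [hj, ht]
      · simp [hj]
    have h2 : (univ.filter fun j => θ (Function.update v i t i) <
        θ (Function.update v i t j)) = ({j | ℓ < θ (v j)} : Finset (Fin n)).erase i := by
      ext j
      simp only [mem_filter, mem_univ, true_and, Function.update_self, ht, mem_erase]
      by_cases hj : j = i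
      · simp [hj, ht]
      · simp [hj]
    have hiS : i ∈ ({j | ℓ < θ (v j)} : Finset (Fin n)) := by simpa using hi
    rw [h1, h2, card_insert_of_notMem (by simpa using hi.ne'), card_erase_of_mem hiS] at hmain
    have hs1 : 1 ≤ #{j | ℓ < θ (v j)} := card_pos.2 ⟨i, hiS⟩
    set s := #{j | ℓ < θ (v j)}
    set m := #{j | θ (v j) = ℓ}
    rw [← hadd] at hk ⊢
    rw [Nat.cast_sub (by omega), Nat.cast_sub hs1] at hmain
    push_cast at hmain ⊢
    have hs' : (1 : ℝ) ≤ s := by exact_mod_cast hs1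
    have hk' : (k : ℝ) + 1 ≤ s + m := by exact_mod_cast hk
    have hm0 : (0 : ℝ) ≤ m := by positivity
    have h4 : (m + 1) * (x * (s + m)) ≤ (m + 1) * k := by
      have h5 : (m + 1) * x * (s + m) ≤ (k - (s - 1)) * (s + m) :=
        mul_le_mul_of_nonneg_right hmain (by linarith)
      nlinarith [mul_nonneg (sub_nonneg.2 hs') (sub_nonneg.2 hk')]
    exact le_of_mul_le_mul_left h4 (by linarith)

end Update

/-- The utilities induced by a monotone virtual valuation are bounded by those of two lotteries. -/
theorem sum_integral_allocProb_le {k : ℕ} {θ : ℝ → ℝ} (hθ : Monotone θ) {v : Fin n → ℝ}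
    (hv : ∀ i, 0 ≤ v i) :
    ∃ p q, 0 ≤ p ∧ 0 ≤ q ∧
      ∑ i, ∫ t in (0 : ℝ)..v i, allocProb k θ (Function.update v i t) i ≤
        lottery k v univ p + lottery k v univ q := by
  rcases le_or_gt n k with hnk | hnk
  · refine ⟨0, 0, le_rfl, le_rfl, ?_⟩
    refine (sum_le_sum fun i _ => ?_).trans (b := excess v univ 0) ?_
    · have h := integral_le_of_le_step (x := fun t => allocProb k θ (Function.update v i t) i)
        (c := 0) le_rfl le_rfl le_rfl (hv i) (fun t h _ h' => absurd h (not_le.2 h'))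
        (fun t h _ h' => absurd h (not_le.2 h')) (fun t => allocProb_le_one _ _ _ _)
      rwa [zero_mul, zero_add] at h
    · have h := excess_le_lottery (k := k) (v := v) (T := univ) (p := 0)
        ((card_le_univ _).trans (by simpa using hnk))
      linarith [lottery_nonneg k v univ 0]
  obtain ⟨ℓ, hs, hk⟩ := exists_critical_level hnk fun j => θ (v j)
  obtain ⟨p, hp, hp1, hp2⟩ := exists_cutoff hv (D := {z | ℓ < θ z})
    fun s hs t hst => lt_of_lt_of_le hs (hθ hst)
  obtain ⟨q, hq, hq1, hq2⟩ := exists_cutoff hv (D := {z | ℓ ≤ θ z})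
    fun s hs t hst => le_trans hs (hθ hst)
  refine ⟨p, q, hp, hq, ?_⟩
  -- At price p every buyer is served; at price q each is served with probability at least the rate
  -- k / #{j | ℓ ≤ θ(v_j)} that bounds the allocation on the level ℓ.
  have hbp : #(buyers v univ p) ≤ k := (card_le_card fun i hi => by
    simpa using hp2 i (mem_filter.1 hi).2).trans hs
  have hbq : #(buyers v univ q) ≤ #{j | ℓ ≤ θ (v j)} := card_le_card fun i hi => by
    simpa using hq2 i (mem_filter.1 hi).2
  have hLp := excess_le_lottery hbp
  have hLq := div_mul_excess_le_lottery hk.le hbq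
  refine le_trans ?_ (add_le_add hLp hLq)
  rw [excess, excess, mul_sum, ← sum_add_distrib]
  refine sum_le_sum fun i _ => ?_
  rw [add_comm]
  have hc : (0 : ℝ) ≤ k / #{j | ℓ ≤ θ (v j)} := by positivity
  refine integral_le_of_le_step hc hp hq (hv i) ?_ ?_ fun t => allocProb_le_one _ _ _ _
  · intro t ht _ htq
    exact (allocProb_update_eq_zero hk i (not_le.1 (hq1 t ht htq))).le
  · intro t ht hti htp
    rcases (show θ t ≤ ℓ from not_lt.1 (hp1 t ht htp)).lt_or_eq with h | h
    · rw [allocProb_update_eq_zero hk i h]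
      exact hc
    · exact allocProb_update_level_le hs hk (h ▸ hθ hti.le) h

/-! ### Comparison of sums by superlevel sets -/

section LayerCake

variable {ι : Type*}

theorem integral_one_sub_indicator_Ici {a M : ℝ} (ha : 0 ≤ a) (haM : a ≤ M) :
    ∫ t in (0 : ℝ)..M, (1 - (Set.Ici a).indicator (fun _ => (1 : ℝ)) t) = a := by
  rw [intervalIntegral.integral_sub intervalIntegrable_const
    (intervalIntegrable_indicator_Ici a 0 M), integral_indicator_Ici ha (ha.trans haM),
    max_eq_left (sub_nonneg.2 haM), intervalIntegral.integral_const]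
  simp

theorem sum_eq_integral_card {T : Finset ι} {u : ι → ℝ} {M : ℝ} (hu : ∀ j ∈ T, 0 ≤ u j)
    (hM : ∀ j ∈ T, u j ≤ M) :
    ∑ j ∈ T, u j = ∫ t in (0 : ℝ)..M, (#{j ∈ T | t < u j} : ℝ) := by
  have h : ∀ t, (#{j ∈ T | t < u j} : ℝ) =
      ∑ j ∈ T, (1 - (Set.Ici (u j)).indicator (fun _ => (1 : ℝ)) t) := by
    intro t
    rw [← sum_boole]
    refine sum_congr rfl fun j _ => ?_
    by_cases hj : t < u j
    · simp [hj]
    · simp [hj, not_lt.1 hj]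
  simp only [h]
  rw [intervalIntegral.integral_finsetSum fun j _ =>
    intervalIntegrable_const.sub (intervalIntegrable_indicator_Ici _ _ _)]
  exact sum_congr rfl fun j hj => (integral_one_sub_indicator_Ici (hu j hj) (hM j hj)).symm

theorem intervalIntegrable_card (T : Finset ι) (u : ι → ℝ) (a b : ℝ) :
    IntervalIntegrable (fun t => (#{j ∈ T | t < u j} : ℝ)) MeasureTheory.volume a b := by
  refine Antitone.intervalIntegrable fun s t hst => ?_
  exact_mod_cast card_le_card (monotone_filter_right T fun j _ h => hst.trans_lt h)

/-- Comparison of sums through the cardinalities of the superlevel sets. -/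
theorem sum_le_mul_sum_of_card_le {T U : Finset ι} {u : ι → ℝ} (hu : ∀ j, 0 ≤ u j) {c : ℝ}
    (h : ∀ t, 0 ≤ t → (#{j ∈ T | t < u j} : ℝ) ≤ c * #{j ∈ U | t < u j}) :
    ∑ j ∈ T, u j ≤ c * ∑ j ∈ U, u j := by
  have hT : ∀ j ∈ T, u j ≤ ∑ i ∈ T, u i + ∑ i ∈ U, u i := fun j hj =>
    (single_le_sum (fun i _ => hu i) hj).trans (le_add_of_nonneg_right (sum_nonneg fun i _ => hu i))
  have hU : ∀ j ∈ U, u j ≤ ∑ i ∈ T, u i + ∑ i ∈ U, u i := fun j hj =>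
    (single_le_sum (fun i _ => hu i) hj).trans (le_add_of_nonneg_left (sum_nonneg fun i _ => hu i))
  have hM : 0 ≤ ∑ i ∈ T, u i + ∑ i ∈ U, u i :=
    add_nonneg (sum_nonneg fun i _ => hu i) (sum_nonneg fun i _ => hu i)
  generalize ∑ i ∈ T, u i + ∑ i ∈ U, u i = M at hT hU hM
  rw [sum_eq_integral_card (fun j _ => hu j) hT, sum_eq_integral_card (fun j _ => hu j) hU,
    ← intervalIntegral.integral_const_mul]
  exact intervalIntegral.integral_mono_on hM (intervalIntegrable_card _ _ _ _)
    ((intervalIntegrable_card _ _ _ _).const_mul c) fun t ht => h t ht.1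

end LayerCake

/-! ### Lower bounds for the Vickrey auction -/

section Vickrey

variable {k : ℕ} {v : Fin n → ℝ}

theorem getD_sortedValues_le (hv : ∀ i, 0 ≤ v i) (T : Finset (Fin n)) {x : ℝ}
    (hx : x ∈ (sortedValues v T).take k) : (sortedValues v T).getD k 0 ≤ x := by
  have hsort : (sortedValues v T).Pairwise (· ≥ ·) := Multiset.pairwise_sort _ _
  rcases lt_or_ge k (sortedValues v T).length with hk | hk
  · rw [List.getD_eq_getElem _ _ hk]
    obtain ⟨i, hi, rfl⟩ := List.mem_take_iff_getElem.1 hx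
    exact List.pairwise_iff_getElem.1 hsort i k _ hk (by omega)
  · rw [List.getD_eq_default _ _ hk]
    have hx' := List.mem_of_mem_take hx
    rw [sortedValues, Multiset.mem_sort, Multiset.mem_map] at hx'
    obtain ⟨i, -, rfl⟩ := hx'
    exact hv i

theorem vickrey_nonneg (hv : ∀ i, 0 ≤ v i) (T : Finset (Fin n)) : 0 ≤ vickrey k v T := by
  refine List.sum_nonneg fun y hy => ?_
  obtain ⟨x, hx, rfl⟩ := List.mem_map.1 hy
  exact sub_nonneg.2 (getD_sortedValues_le hv T hx)

/-- The Vickrey auction extracts at least the gap between the two highest valuations. -/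
theorem sub_le_vickrey (hk : 1 ≤ k) (hv : ∀ i, 0 ≤ v i) {T : Finset (Fin n)} {i : Fin n} {r : ℝ}
    (hi : i ∈ T) (hr : 0 ≤ r) (hri : r ≤ v i) (hle : ∀ j, j ≠ i → v j ≤ r) :
    v i - r ≤ vickrey k v T := by
  obtain ⟨m, rfl⟩ : ∃ m, k = m + 1 := ⟨k - 1, by omega⟩
  have hl : sortedValues v T = v i :: ((T.erase i).val.map v).sort (· ≥ ·) := by
    rw [sortedValues, ← Multiset.sort_cons]
    · rw [← Multiset.map_cons, ← insert_val_of_notMem (notMem_erase i T), insert_erase hi]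
    · intro b hb
      obtain ⟨j, hj, rfl⟩ := Multiset.mem_map.1 hb
      exact (hle j (ne_of_mem_erase hj)).trans hri
  have hnn : ∀ y ∈ ((sortedValues v T).take (m + 1)).map
      fun x => x - (sortedValues v T).getD (m + 1) 0, 0 ≤ y := by
    intro y hy
    obtain ⟨x, hx, rfl⟩ := List.mem_map.1 hy
    exact sub_nonneg.2 (getD_sortedValues_le hv T hx)
  rw [vickrey]
  rw [hl] at hnn ⊢
  rw [List.take_succ_cons, List.map_cons] at hnn ⊢
  rw [List.sum_cons]
  have hrest := List.sum_nonneg fun y hy => hnn y (List.mem_cons_of_mem _ hy)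
  have hd : (v i :: ((T.erase i).val.map v).sort (· ≥ ·)).getD (m + 1) 0 ≤ r := by
    rw [List.getD_cons_succ]
    rcases lt_or_ge m (((T.erase i).val.map v).sort (· ≥ ·)).length with hm | hm
    · rw [List.getD_eq_getElem _ _ hm]
      have hx := List.getElem_mem hm
      rw [Multiset.mem_sort, Multiset.mem_map] at hx
      obtain ⟨j, hj, hjx⟩ := hx
      rw [← hjx]
      exact hle j (ne_of_mem_erase hj)
    · rw [List.getD_eq_default _ _ hm]
      exact hr
  linarith

end Vickrey

/-! ### Surplus on a balanced sample -/

/-- The sample `S` contains the highest agent `i`, a constant fraction of the buyers at every price,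
and its complement contains a constant fraction of the buyers at every price below `r`. -/
def IsBalanced (v : Fin n → ℝ) (i : Fin n) (r : ℝ) (S : Finset (Fin n)) : Prop :=
  i ∈ S ∧ (∀ t, 0 ≤ t → #(buyers v univ t) ≤ 16 * #(buyers v S t)) ∧
    ∀ t, 0 ≤ t → t < r → #(buyers v univ t) ≤ 16 * #(buyers v Sᶜ t)

section Balanced

variable {k : ℕ} {v : Fin n → ℝ} {i : Fin n} {r p : ℝ} {S : Finset (Fin n)}

theorem buyers_mono {T U : Finset (Fin n)} (h : T ⊆ U) (p : ℝ) : buyers v T p ⊆ buyers v U p :=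
  filter_subset_filter _ h

/-- The superlevel sets of the excess over p are the buyer sets at prices p + t, so balance at every
price integrates. -/
theorem excess_univ_le (hS : IsBalanced v i r S) (hp : 0 ≤ p) :
    excess v univ p ≤ 16 * excess v S p := by
  refine sum_le_mul_sum_of_card_le (fun j => le_max_right _ _) fun t ht => ?_
  have h : ∀ T : Finset (Fin n), {j ∈ T | t < max (v j - p) 0} = buyers v T (p + t) := by
    intro T
    refine filter_congr fun j _ => ?_
    rw [lt_max_iff, or_iff_left (not_lt.2 ht), lt_sub_iff_add_lt']
  rw [h, h]
  exact_mod_cast hS.2.1 (p + t) (add_nonneg hp ht)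

/-- The complement lacks i, so balance there holds only below r. Truncating valuations at r confines
the layers to those prices and changes only i, by at most v_i - r. -/
theorem excess_univ_le_compl (hS : IsBalanced v i r S) (hp : 0 ≤ p) (hri : r ≤ v i)
    (hle : ∀ j, j ≠ i → v j ≤ r) :
    excess v univ p ≤ 16 * excess v Sᶜ p + (v i - r) := by
  have h1 : ∑ j, min (max (v j - p) 0) (max (r - p) 0) ≤
      16 * ∑ j ∈ Sᶜ, min (max (v j - p) 0) (max (r - p) 0) := by
    refine sum_le_mul_sum_of_card_le
      (fun j => le_min (le_max_right _ _) (le_max_right _ _)) fun t ht => ?_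
    have h : ∀ T : Finset (Fin n), {j ∈ T | t < min (max (v j - p) 0) (max (r - p) 0)} =
        if p + t < r then buyers v T (p + t) else ∅ := by
      intro T
      split_ifs with hr
      · refine filter_congr fun j _ => ?_
        rw [lt_min_iff, lt_max_iff, lt_max_iff, or_iff_left (not_lt.2 ht),
          or_iff_left (not_lt.2 ht), lt_sub_iff_add_lt', lt_sub_iff_add_lt', and_iff_left hr]
      · refine filter_false_of_mem fun j _ => ?_
        rw [lt_min_iff, lt_max_iff, lt_max_iff, or_iff_left (not_lt.2 ht),
          or_iff_left (not_lt.2 ht), lt_sub_iff_add_lt', lt_sub_iff_add_lt']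
        exact fun h => hr h.2
    rw [h, h]
    split_ifs with hr
    · exact_mod_cast hS.2.2 (p + t) (add_nonneg hp ht) hr
    · simp
  have h2 : excess v univ p ≤ ∑ j, min (max (v j - p) 0) (max (r - p) 0) + (v i - r) := by
    rw [excess, ← add_sum_erase _ _ (mem_univ i), ← add_sum_erase _ _ (mem_univ i)]
    have h3 : ∑ j ∈ univ.erase i, max (v j - p) 0 =
        ∑ j ∈ univ.erase i, min (max (v j - p) 0) (max (r - p) 0) := by
      refine sum_congr rfl fun j hj => (min_eq_left ?_).symm
      exact max_le_max_right _ (sub_le_sub_right (hle j (ne_of_mem_erase hj)) _)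
    have h4 : max (v i - p) 0 ≤ min (max (v i - p) 0) (max (r - p) 0) + (v i - r) := by
      rw [min_eq_right (max_le_max_right _ (sub_le_sub_right hri _))]
      refine max_le ?_ ?_
      · linarith [le_max_left (r - p) 0]
      · linarith [le_max_right (r - p) 0]
    linarith
  have h5 : ∑ j ∈ Sᶜ, min (max (v j - p) 0) (max (r - p) 0) ≤ excess v Sᶜ p :=
    sum_le_sum fun j _ => min_le_left _ _
  linarith

/-- The service probability min(k, b)/b decreases in the number b of buyers, so restriction to a
subset can only raise it. -/
theorem rate_mul_excess_le_lottery {T U : Finset (Fin n)} (h : T ⊆ U) :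
    ((min k #(buyers v U p) : ℕ) / (#(buyers v U p) : ℝ)) * excess v T p ≤ lottery k v T p := by
  rcases (buyers v T p).eq_empty_or_nonempty with he | hne
  · rw [excess_eq_zero he, mul_zero]
    exact lottery_nonneg _ _ _ _
  have hT : 0 < #(buyers v T p) := card_pos.2 hne
  have hTU := card_le_card (buyers_mono (v := v) h p)
  rw [lottery_eq]
  refine mul_le_mul_of_nonneg_right ?_ (excess_nonneg _ _ _)
  rw [div_le_div_iff₀ (by exact_mod_cast hT.trans_le hTU) (by exact_mod_cast hT)]
  norm_cast
  rcases le_total k #(buyers v T p) with hk | hk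
  · rw [min_eq_left (hk.trans hTU), min_eq_left hk]
    gcongr
  · rw [min_eq_right hk, mul_comm]
    gcongr
    exact min_le_right _ _

theorem rate_le_one (k b : ℕ) : ((min k b : ℕ) / (b : ℝ)) ≤ 1 :=
  div_le_one_of_le₀ (by exact_mod_cast min_le_right _ _) (by positivity)

theorem lottery_univ_le (hS : IsBalanced v i r S) (hp : 0 ≤ p) (hri : r ≤ v i)
    (hle : ∀ j, j ≠ i → v j ≤ r) :
    lottery k v univ p ≤ 16 * lottery k v Sᶜ p + (v i - r) := by
  have h1 := rate_mul_excess_le_lottery (k := k) (v := v) (p := p) (subset_univ Sᶜ)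
  have h2 := rate_le_one k #(buyers v univ p)
  have h0 : (0 : ℝ) ≤ (min k #(buyers v univ p) : ℕ) / (#(buyers v univ p) : ℝ) := by positivity
  have h3 := excess_univ_le_compl hS hp hri hle
  rw [lottery_eq k v univ p]
  set ρ := (min k #(buyers v univ p) : ℕ) / (#(buyers v univ p) : ℝ)
  calc ρ * excess v univ p ≤ ρ * (16 * excess v Sᶜ p + (v i - r)) :=
        mul_le_mul_of_nonneg_left h3 h0
    _ = 16 * (ρ * excess v Sᶜ p) + ρ * (v i - r) := by ring
    _ ≤ 16 * lottery k v Sᶜ p + 1 * (v i - r) := by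
        have := sub_nonneg.2 hri
        gcongr
    _ = _ := by ring

/-- One factor 16 is lost in the service probability and one in the excess. At prices from r on the
complement has no buyers, as i lies in S. -/
theorem lottery_compl_le (hS : IsBalanced v i r S) (hp : 0 ≤ p) (hle : ∀ j, j ≠ i → v j ≤ r) :
    lottery k v Sᶜ p ≤ 256 * lottery k v S p := by
  have hSnn := lottery_nonneg k v S p
  rw [lottery_eq k v Sᶜ p]
  rcases (buyers v Sᶜ p).eq_empty_or_nonempty with he | ⟨j, hj⟩
  · rw [excess_eq_zero he, mul_zero]
    positivity
  have hpr : p < r := by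
    rw [buyers, mem_filter, mem_compl] at hj
    exact hj.2.trans_le (hle j fun h => hj.1 (h ▸ hS.1))
  have hb := hS.2.2 p hp hpr
  have hc : 0 < #(buyers v Sᶜ p) := card_pos.2 ⟨j, hj⟩
  have hcb := card_le_card (buyers_mono (v := v) (subset_univ Sᶜ) p)
  have hrate : ((min k #(buyers v Sᶜ p) : ℕ) / (#(buyers v Sᶜ p) : ℝ)) ≤
      16 * ((min k #(buyers v univ p) : ℕ) / (#(buyers v univ p) : ℝ)) := by
    rw [← mul_div_assoc, div_le_div_iff₀ (by exact_mod_cast hc)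
      (by exact_mod_cast hc.trans_le hcb)]
    norm_cast
    calc min k #(buyers v Sᶜ p) * #(buyers v univ p)
        ≤ min k #(buyers v univ p) * (16 * #(buyers v Sᶜ p)) := by gcongr
      _ = _ := by ring
  have h1 := rate_mul_excess_le_lottery (k := k) (v := v) (p := p) (subset_univ S)
  have h0 : (0 : ℝ) ≤ (min k #(buyers v univ p) : ℕ) / (#(buyers v univ p) : ℝ) := by positivity
  have h2 := (excess_mono v (subset_univ Sᶜ) p).trans (excess_univ_le hS hp)
  set ρ := (min k #(buyers v univ p) : ℕ) / (#(buyers v univ p) : ℝ)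
  calc _ ≤ (16 * ρ) * (16 * excess v S p) :=
        mul_le_mul hrate h2 (excess_nonneg _ _ _) (by positivity)
    _ = 256 * (ρ * excess v S p) := by ring
    _ ≤ _ := by gcongr

theorem lottery_le_of_isBalanced (hk : 1 ≤ k) (hv : ∀ i, 0 ≤ v i) (hS : IsBalanced v i r S)
    (hp : 0 ≤ p) (hr : 0 ≤ r) (hri : r ≤ v i) (hle : ∀ j, j ≠ i → v j ≤ r) {p₂ : ℝ}
    (hp₂ : IsOptimalPrice k v Sᶜ p₂) :
    lottery k v univ p ≤ 8192 * (1 / 2 * lottery k v S p₂ + 1 / 2 * vickrey k v S) := by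
  -- The losses multiply to 16 · 256 = 4096, doubled because each of the two mechanisms is run with
  -- probability 1/2.
  have h1 := lottery_univ_le (k := k) hS hp hri hle
  have h2 := hp₂.2 p hp
  have h3 := lottery_compl_le (k := k) hS hp₂.1 hle
  have h4 := sub_le_vickrey hk hv hS.1 hr hri hle
  have h5 := vickrey_nonneg (k := k) hv S
  linarith

end Balanced

/-! ### Random samples are balanced with constant probability -/

section Sampling

variable {α : Type*} [Fintype α] [DecidableEq α]

/-- A generating function: expanded over the choices in or out, the sum is a product with factor x
for a (forced in), 1 for b (forced out), 1 + x for the rest of U and 2 outside U. -/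
theorem sum_pow_card_inter {U : Finset α} {a b : α} (ha : a ∈ U) (hb : b ∈ U) (hab : a ≠ b) {x : ℝ}
    (hx : 0 < x) :
    ∑ S : Finset α with a ∈ S ∧ b ∉ S, x ^ #(S ∩ U) =
      2 ^ Fintype.card α * ((1 + x) / 2) ^ #U * (x / (1 + x) ^ 2) := by
  have key := prod_add (fun j => if j = b then 0 else if j ∈ U then x else 1)
    (fun j => if j = a then (0 : ℝ) else 1) (univ : Finset α)
  have hfac : ∀ j, ((if j = b then 0 else if j ∈ U then x else 1) + if j = a then (0 : ℝ) else 1) =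
      2 * (if j ∈ U then (1 + x) / 2 else 1) * (if j = a then x / (1 + x) else 1) *
        (if j = b then 1 / (1 + x) else 1) := by
    intro j
    have hx1 : 1 + x ≠ 0 := by positivity
    by_cases hja : j = a
    · subst hja
      simp only [hab, ha, if_true, if_false]
      field_simp
      ring
    · by_cases hjb : j = b
      · subst hjb
        simp only [hja, hb, if_true, if_false]
        field_simp
        ring
      · simp only [hja, hjb, if_false]
        split_ifs
        · ring
        · norm_num
  rw [prod_congr rfl fun j _ => hfac j, prod_mul_distrib, prod_mul_distrib, prod_mul_distrib,
    prod_const, card_univ, prod_ite_eq' univ a, prod_ite_eq' univ b, if_pos (mem_univ _),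
    if_pos (mem_univ _), prod_ite_mem, univ_inter, prod_const, powerset_univ] at key
  have hterm : ∀ S : Finset α, (∏ j ∈ S, if j = b then 0 else if j ∈ U then x else 1) *
      ∏ j ∈ univ \ S, (if j = a then (0 : ℝ) else 1) =
      if a ∈ S ∧ b ∉ S then x ^ #(S ∩ U) else 0 := by
    intro S
    by_cases hbS : b ∈ S
    · rw [prod_eq_zero hbS (by simp), zero_mul, if_neg (fun h => h.2 hbS)]
    by_cases haS : a ∈ S
    · rw [if_pos ⟨haS, hbS⟩, prod_congr rfl (g := fun j => if j ∈ U then x else 1),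
        prod_ite_mem, prod_const, prod_eq_one, mul_one]
      · intro j hj
        rw [if_neg]
        rintro rfl
        exact (mem_sdiff.1 hj).2 haS
      · intro j hj
        rw [if_neg]
        rintro rfl
        exact hbS hj
    · rw [if_neg (fun h => haS h.1), prod_eq_zero (i := a) (s := univ \ S) (by simp [haS]) (by simp),
        mul_zero]
  rw [sum_filter, ← sum_congr rfl fun S _ => hterm S, ← key]
  have hx1 : 1 + x ≠ 0 := by positivity
  field_simp

/-- An exponential moment bound for the lower tail of the size of a random sample. -/
theorem card_small_inter_le {U : Finset α} {a b : α} (ha : a ∈ U) (hb : b ∈ U) (hab : a ≠ b) :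
    (#{S : Finset α | (a ∈ S ∧ b ∉ S) ∧ 16 * #(S ∩ U) < #U} : ℝ) ≤
      2 ^ Fintype.card α * (2 / 9 * (63 / 80) ^ #U) := by
  -- On the bad event the weight (21/20)^|U| (1/2)^|S ∩ U| is at least 1, because (21/20)^16 > 2.
  -- Summing it gives the ratio 63/80 = (21/20)(3/4) and the factor 2/9 = (1/2)/(3/2)².
  have hsum := sum_pow_card_inter ha hb hab (x := 1 / 2) (by norm_num)
  calc (#{S : Finset α | (a ∈ S ∧ b ∉ S) ∧ 16 * #(S ∩ U) < #U} : ℝ)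
      = ∑ S : Finset α with (a ∈ S ∧ b ∉ S) ∧ 16 * #(S ∩ U) < #U, 1 := by simp
    _ ≤ ∑ S : Finset α with (a ∈ S ∧ b ∉ S) ∧ 16 * #(S ∩ U) < #U,
          (21 / 20 : ℝ) ^ #U * (1 / 2) ^ #(S ∩ U) := by
        refine sum_le_sum fun S hS => ?_
        have hlt := (mem_filter.1 hS).2.2
        calc (1 : ℝ) ≤ ((21 / 20) ^ 16 * (1 / 2)) ^ #(S ∩ U) := one_le_pow₀ (by norm_num)
          _ = (21 / 20) ^ (16 * #(S ∩ U)) * (1 / 2) ^ #(S ∩ U) := by rw [mul_pow, pow_mul]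
          _ ≤ _ := by
            gcongr
            norm_num
    _ ≤ ∑ S : Finset α with a ∈ S ∧ b ∉ S, (21 / 20 : ℝ) ^ #U * (1 / 2) ^ #(S ∩ U) := by
        refine sum_le_sum_of_subset_of_nonneg ?_ fun _ _ _ => by positivity
        exact monotone_filter_right _ fun S _ h => h.1
    _ = _ := by
        rw [← mul_sum, hsum, show (63 / 80 : ℝ) = 21 / 20 * ((1 + 1 / 2) / 2) by norm_num, mul_pow]
        ring

theorem card_small_compl_inter_le {U : Finset α} {a b : α} (ha : a ∈ U) (hb : b ∈ U)
    (hab : a ≠ b) :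
    (#{S : Finset α | (a ∈ S ∧ b ∉ S) ∧ 16 * #(Sᶜ ∩ U) < #U} : ℝ) ≤
      2 ^ Fintype.card α * (2 / 9 * (63 / 80) ^ #U) := by
  refine le_trans ?_ (card_small_inter_le hb ha hab.symm)
  norm_cast
  refine card_le_card_of_injOn compl (fun S hS => ?_) compl_injective.injOn
  simp only [coe_filter, mem_univ, true_and, Set.mem_ofPred_eq, mem_compl, not_not] at hS ⊢
  exact ⟨⟨hS.1.2, hS.1.1⟩, hS.2⟩

theorem card_separating {a b : α} (hab : a ≠ b) :
    (#{S : Finset α | a ∈ S ∧ b ∉ S} : ℝ) = 2 ^ Fintype.card α / 4 := by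
  have h := sum_pow_card_inter (mem_univ a) (mem_univ b) hab (x := 1) one_pos
  norm_num at h
  rw [h]
  ring

/-- For a chain of sets containing `a` and `b`, a random sample which contains `a` but not `b` is
balanced on the whole chain with constant probability. -/
theorem card_balanced_chain {a b : α} (hab : a ≠ b) {𝒰 : Finset (Finset α)}
    (h𝒰 : ∀ U ∈ 𝒰, ∀ V ∈ 𝒰, U ⊆ V ∨ V ⊆ U) (hmem : ∀ U ∈ 𝒰, a ∈ U ∧ b ∈ U) :
    (2 : ℝ) ^ Fintype.card α ≤ 5 * #{S : Finset α | (a ∈ S ∧ b ∉ S) ∧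
      ∀ U ∈ 𝒰, #U ≤ 16 * #(S ∩ U) ∧ #U ≤ 16 * #(Sᶜ ∩ U)} := by
  set N := Fintype.card α
  -- Sets of at most 16 elements are balanced automatically, since a lies in S and b in its
  -- complement; only larger ones enter the union bound.
  set 𝒱 := 𝒰.filter fun U => 17 ≤ #U
  set E : Finset (Finset α) := univ.filter fun S => a ∈ S ∧ b ∉ S
  set B₁ : Finset (Finset α) :=
    𝒱.biUnion fun U => univ.filter fun S => (a ∈ S ∧ b ∉ S) ∧ 16 * #(S ∩ U) < #U
  set B₂ : Finset (Finset α) :=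
    𝒱.biUnion fun U => univ.filter fun S => (a ∈ S ∧ b ∉ S) ∧ 16 * #(Sᶜ ∩ U) < #U
  set Q : Finset (Finset α) := univ.filter fun S => (a ∈ S ∧ b ∉ S) ∧
      ∀ U ∈ 𝒰, #U ≤ 16 * #(S ∩ U) ∧ #U ≤ 16 * #(Sᶜ ∩ U)
  have hcover : E ⊆ Q ∪ (B₁ ∪ B₂) := by
    intro S hS
    have hS' := (mem_filter.1 hS).2
    by_contra hcon
    simp only [mem_union, not_or] at hcon
    obtain ⟨hQ, hB₁, hB₂⟩ := hcon
    refine hQ (mem_filter.2 ⟨mem_univ _, hS', fun U hU => ?_⟩)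
    obtain ⟨haU, hbU⟩ := hmem U hU
    have h1 : 1 ≤ #(S ∩ U) := card_pos.2 ⟨a, mem_inter.2 ⟨hS'.1, haU⟩⟩
    have h2 : 1 ≤ #(Sᶜ ∩ U) := card_pos.2 ⟨b, mem_inter.2 ⟨mem_compl.2 hS'.2, hbU⟩⟩
    by_cases h17 : 17 ≤ #U
    · have hU𝒱 : U ∈ 𝒱 := mem_filter.2 ⟨hU, h17⟩
      constructor
      · by_contra hlt
        exact hB₁ (mem_biUnion.2 ⟨U, hU𝒱, mem_filter.2 ⟨mem_univ _, hS', not_le.1 hlt⟩⟩)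
      · by_contra hlt
        exact hB₂ (mem_biUnion.2 ⟨U, hU𝒱, mem_filter.2 ⟨mem_univ _, hS', not_le.1 hlt⟩⟩)
    · omega
  have hgeom : ∑ U ∈ 𝒱, (63 / 80 : ℝ) ^ #U ≤ (63 / 80) ^ 17 / (1 - 63 / 80) := by
    -- Members of a chain are determined by their cardinalities, so the union bound is dominated by
    -- a geometric series.
    have hinj : Set.InjOn card (𝒱 : Set (Finset α)) := by
      intro U hU V hV hUV
      rcases h𝒰 U (mem_filter.1 hU).1 V (mem_filter.1 hV).1 with h | h
      · exact eq_of_subset_of_card_le h hUV.ge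
      · exact (eq_of_subset_of_card_le h hUV.le).symm
    calc ∑ U ∈ 𝒱, (63 / 80 : ℝ) ^ #U = ∑ m ∈ 𝒱.image card, (63 / 80 : ℝ) ^ m :=
          (sum_image hinj).symm
      _ ≤ ∑ m ∈ Ico 17 (N + 1), (63 / 80 : ℝ) ^ m := by
          refine sum_le_sum_of_subset_of_nonneg (fun m hm => ?_) fun _ _ _ => by positivity
          obtain ⟨U, hU, rfl⟩ := mem_image.1 hm
          exact mem_Ico.2 ⟨(mem_filter.1 hU).2, Nat.lt_succ_of_le (card_le_univ U)⟩
      _ ≤ _ := geom_sum_Ico_le_of_lt_one (by norm_num) (by norm_num)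
  -- Each side fails with probability at most 1/50, which leaves 1/4 - 2/50 > 1/5.
  have hnum : (2 / 9 : ℝ) * ((63 / 80) ^ 17 / (1 - 63 / 80)) ≤ 1 / 50 := by norm_num
  have hpow : (0 : ℝ) < 2 ^ N := by positivity
  have hunion : (2 : ℝ) ^ N * (2 / 9 * ∑ U ∈ 𝒱, (63 / 80 : ℝ) ^ #U) ≤ 2 ^ N * (1 / 50) := by
    gcongr
    linarith
  have hB₁ : (#B₁ : ℝ) ≤ 2 ^ N * (1 / 50) := by
    refine le_trans ?_ hunion
    rw [mul_sum, mul_sum]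
    refine le_trans (by exact_mod_cast card_biUnion_le) (le_trans (Nat.cast_sum _ _).le ?_)
    refine sum_le_sum fun U hU => ?_
    obtain ⟨haU, hbU⟩ := hmem U (mem_filter.1 hU).1
    exact card_small_inter_le haU hbU hab
  have hB₂ : (#B₂ : ℝ) ≤ 2 ^ N * (1 / 50) := by
    refine le_trans ?_ hunion
    rw [mul_sum, mul_sum]
    refine le_trans (by exact_mod_cast card_biUnion_le) (le_trans (Nat.cast_sum _ _).le ?_)
    refine sum_le_sum fun U hU => ?_
    obtain ⟨haU, hbU⟩ := hmem U (mem_filter.1 hU).1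
    exact card_small_compl_inter_le haU hbU hab
  have hE : (#E : ℝ) = 2 ^ N / 4 := card_separating hab
  have hcard : (#E : ℝ) ≤ #Q + (#B₁ + #B₂) := by
    exact_mod_cast (card_le_card hcover).trans ((card_union_le _ _).trans
      (Nat.add_le_add_left (card_union_le _ _) _))
  linarith

end Sampling

theorem buyers_eq_inter (v : Fin n → ℝ) (S : Finset (Fin n)) (t : ℝ) :
    buyers v S t = S ∩ buyers v univ t := by
  ext j
  simp [buyers]

open Classical in
/-- A uniformly random sample is balanced with probability at least `1 / 5`. -/
theorem exists_card_isBalanced (hn : 0 < n) {v : Fin n → ℝ} (hv : ∀ i, 0 ≤ v i) :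
    ∃ i r, 0 ≤ r ∧ r ≤ v i ∧ (∀ j, j ≠ i → v j ≤ r) ∧
      (2 : ℝ) ^ n ≤ 5 * #{S : Finset (Fin n) | IsBalanced v i r S} := by
  obtain ⟨i, -, hi⟩ := exists_max_image univ v ⟨⟨0, hn⟩, mem_univ _⟩
  rcases (univ.erase i).eq_empty_or_nonempty with he | hne
  · have hall : ∀ j, j = i := by
      intro j
      by_contra hj
      exact notMem_empty j (he ▸ mem_erase.2 ⟨hj, mem_univ j⟩)
    have hn1 : n = 1 := by
      have := card_erase_of_mem (mem_univ i)
      rw [he, card_empty, card_fin] at this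
      omega
    -- For a single agent r = 0 makes the condition on the complement vacuous, and the full sample
    -- is balanced.
    refine ⟨i, 0, le_rfl, hv i, fun j hj => absurd (hall j) hj, ?_⟩
    have hpos : 1 ≤ #{S : Finset (Fin n) | IsBalanced v i 0 S} := by
      refine card_pos.2 ⟨univ, mem_filter.2 ⟨mem_univ _, mem_univ _, fun t _ => by omega,
        fun t ht ht' => absurd ht (not_le.2 ht')⟩⟩
    have hpos' : (1 : ℝ) ≤ #{S : Finset (Fin n) | IsBalanced v i 0 S} := by exact_mod_cast hpos
    have h2 : (2 : ℝ) ^ n = 2 := by rw [hn1, pow_one]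
    linarith
  obtain ⟨j, hj, hjmax⟩ := exists_max_image (univ.erase i) v hne
  have hji := ne_of_mem_erase hj
  refine ⟨i, v j, hv j, hi j (mem_univ j), fun m hm => hjmax m (mem_erase.2 ⟨hm, mem_univ m⟩), ?_⟩
  -- Buyer sets at prices below the second highest valuation are nested and all contain the two
  -- highest agents i and j.
  set 𝒰 : Finset (Finset (Fin n)) :=
    univ.filter fun U => ∃ t, U = buyers v univ t ∧ t < v j
  have hcount := card_balanced_chain hji.symm (𝒰 := 𝒰) ?_ ?_
  · rw [Fintype.card_fin] at hcount
    refine hcount.trans ?_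
    gcongr with S
    rintro ⟨hS, hbal⟩
    have hlow : ∀ t, t < v j → #(buyers v univ t) ≤ 16 * #(buyers v S t) ∧
        #(buyers v univ t) ≤ 16 * #(buyers v Sᶜ t) := by
      intro t ht
      rw [buyers_eq_inter v S, buyers_eq_inter v Sᶜ]
      exact hbal _ (mem_filter.2 ⟨mem_univ _, t, rfl, ht⟩)
    refine ⟨hS.1, fun t _ => ?_, fun t _ ht => (hlow t ht).2⟩
    rcases lt_or_ge t (v j) with ht | ht
    · exact (hlow t ht).1
    · have hsub : buyers v univ t ⊆ buyers v S t := by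
        intro m hm
        have hm' := (mem_filter.1 hm).2
        have hmi : m = i := by
          by_contra hne
          exact absurd (hjmax m (mem_erase.2 ⟨hne, mem_univ m⟩)) (not_le.2 (ht.trans_lt hm'))
        exact mem_filter.2 ⟨hmi ▸ hS.1, hm'⟩
      have := card_le_card hsub
      omega
  · intro U hU V hV
    obtain ⟨-, s, rfl, -⟩ := mem_filter.1 hU
    obtain ⟨-, t, rfl, -⟩ := mem_filter.1 hV
    rcases le_total s t with h | h
    · exact Or.inr (monotone_filter_right _ fun m _ hm => h.trans_lt hm)
    · exact Or.inl (monotone_filter_right _ fun m _ hm => h.trans_lt hm)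
  · intro U hU
    obtain ⟨-, t, rfl, ht⟩ := mem_filter.1 hU
    exact ⟨mem_filter.2 ⟨mem_univ _, ht.trans_le (hi j (mem_univ j))⟩,
      mem_filter.2 ⟨mem_univ _, ht⟩⟩

/-! ### Assembly of the approximation bound -/

/-- Every sample contributes nonnegatively, so unbalanced ones can be dropped; the constant is 5 ·
8192. -/
theorem lottery_le_rsol {k : ℕ} (hk : 1 ≤ k) {v : Fin n → ℝ} (hv : ∀ i, 0 ≤ v i)
    {price : Finset (Fin n) → ℝ} (hprice : ∀ T, IsOptimalPrice k v T (price T)) {p : ℝ}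
    (hp : 0 ≤ p) : lottery k v univ p ≤ 40960 * rsol k v price := by
  classical
  have hterm : ∀ S, 0 ≤ 1 / 2 * lottery k v S (price Sᶜ) + 1 / 2 * vickrey k v S := by
    intro S
    have := lottery_nonneg k v S (price Sᶜ)
    have := vickrey_nonneg (k := k) hv S
    positivity
  rcases n.eq_zero_or_pos with rfl | hn
  · have h0 : lottery k v univ p = 0 := by
      rw [lottery_eq, excess_eq_zero (by simp [buyers]), mul_zero]
    rw [h0]
    exact mul_nonneg (by norm_num) (expect_nonneg fun S _ => hterm S)
  obtain ⟨i, r, hr, hri, hle, hcard⟩ := exists_card_isBalanced hn hv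
  have hL := lottery_nonneg k v univ p
  have hsum : (#{S : Finset (Fin n) | IsBalanced v i r S} : ℝ) * (lottery k v univ p / 8192) ≤
      ∑ S, (1 / 2 * lottery k v S (price Sᶜ) + 1 / 2 * vickrey k v S) := by
    rw [← nsmul_eq_mul, ← sum_const]
    refine (sum_le_sum fun S hS => ?_).trans (sum_le_sum_of_subset_of_nonneg (subset_univ _)
      fun S _ _ => hterm S)
    have := lottery_le_of_isBalanced hk hv (mem_filter.1 hS).2 hp hr hri hle (hprice Sᶜ)
    linarith
  rw [rsol, Fintype.expect_eq_sum_div_card, Fintype.card_finset, Fintype.card_fin]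
  push_cast
  rw [← mul_div_assoc, le_div_iff₀ (by positivity)]
  have := mul_le_mul_of_nonneg_right hcard hL
  linarith

theorem mye_le_rsol {k : ℕ} (hk : 1 ≤ k) (P : Prior) {v : Fin n → ℝ} (hv : ∀ i, 0 ≤ v i)
    {price : Finset (Fin n) → ℝ} (hprice : ∀ T, IsOptimalPrice k v T (price T)) :
    mye k P v ≤ 81920 * rsol k v price := by
  obtain ⟨p, q, hp, hq, hpq⟩ := sum_integral_allocProb_le (k := k) P.ironed_mono hv
  linarith [mye_le k P hv, lottery_le_rsol hk hv hprice hp, lottery_le_rsol hk hv hprice hq]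

end MoneyBurning

end

theorem mainTheorem2 :
    ∃ β : ℝ, 0 < β ∧
      ∀ (n k : ℕ), 1 ≤ k →
      ∀ v : Fin n → ℝ, (∀ i, 0 ≤ v i) →
      ∀ price : Finset (Fin n) → ℝ,
        (∀ T : Finset (Fin n), MoneyBurning.IsOptimalPrice k v T (price T)) →
        MoneyBurning.benchmark k v ≤ ((β * MoneyBurning.rsol k v price : ℝ) : EReal) := by
  refine ⟨81920, by norm_num, fun n k hk v hv price hprice => iSup_le fun P => ?_⟩
  exact EReal.coe_le_coe_iff.2 (MoneyBurning.mye_le_rsol hk P hv hprice)
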